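/- **Corollary 2.1.** Let $n\in\mathbb N$, $\alpha,\nu,\beta\in(0,1]$, $c>0$, $\lambda>0$. On a probability space let $\mathbf S_n^{2\beta}(t)$, $H_1^{\alpha}(t)$, $H_2^{\nu}(t)$, $t\ge 0$, be independent Lévy processes (started at $0$, stationary independent increments, a.s. càdlàg paths), where $\mathbf S_n^{2\beta}$ is the isotropic stable process in $\mathbb R^n$ with $\mathbb E\,e^{i\xi\cdot \mathbf S_n^{2\beta}(t)}=e^{-t\|\xi\|^{2\beta}}$, and $H_1^\alpha$, $H_2^\nu$ are stable subordinators, i.e. a.s. nondecreasing with $\mathbb E\,e^{-\mu H_1^\alpha(t)}=e^{-t\mu^\alpha}$ and $\mathbb E\,e^{-\mu H_2^\nu(t)}=e^{-t\mu^\nu}$ for $\mu>0$. Put $$L^{\alpha,\nu}(t)=\inf\{s>0:\ H_1^\alpha(s)+(2\lambda)^{1/\nu}H_2^\nu(s)>t\},\qquad \mathbf W(t)=\mathbf S_n^{2\beta}\big(c^2L^{\alpha,\nu}(t)\big),\qquad t\ge 0 .$$ Then $\mathbf W(t)$ is (a.s. equal to) a random vector for every $t\ge 0$, and the family of its laws is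 the unique solution $w=(w_t)_{t\ge0}$ of the fractional Cauchy problem $$\Big(\frac{{}^C\partial^\alpha}{\partial t^\alpha}+2\lambda\frac{{}^C\partial^\nu}{\partial t^\nu}\Big)w=-c^2(-\Delta)^\beta w,\quad x\in\mathbb R^n,\ t>0,\qquad w_0=\delta_0 .$$ Here a solution is a family of finite signed measures $w_t$ on $\mathbb R^n$, $t\ge0$, with total variation bounded on bounded time intervals, such that $w_0=\delta_0$ and, for every complex-valued Schwartz function $\varphi$ on $\mathbb R^n$, the function $u_\varphi(t)=\int\varphi\,dw_t$ satisfies the following. It is continuous on $[0,\infty)$ and differentiable on $(0,\infty)$; for every $t>0$ its derivative is integrable on $(0,t)$, and so is $s\mapsto(t-s)^{-\gamma}u_\varphi'(s)$ for each $\gamma\in\{\alpha,\nu\}$ with $\gamma<1$; and for every $t>0$ $$\frac{{}^C\partial^\alpha}{\partial t^\alpha}u_\varphi(t)+2\lambda\frac{{}^C\partial^\nu}{\partial t^\nu}u_\varphi(t)=-c^2\int_{\mathbb R^n}(-\Delta)^\beta\varphi\,dw_t .$$ The Caputo derivative is $\frac{{}^C\partial^\gamma}{\partial t^\gamma}u(t)=\frac1{\Gamma(1-\gamma)}\int_0^t\frac{u'(s)}{(t-s)^{\gamma}}\,ds$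 for $0<\gamma<1$ and $u'(t)$ for $\gamma=1$, and $(-\Delta)^\beta\varphi(x)=\frac1{(2\pi)^n}\int_{\mathbb R^n}e^{-ix\cdot\xi}\|\xi\|^{2\beta}\widehat\varphi(\xi)\,d\xi$ with $\widehat\varphi(\xi)=\int_{\mathbb R^n}e^{i\xi\cdot x}\varphi(x)\,dx$. -/

import Mathlib

open MeasureTheory ProbabilityTheory Filter Topology Set
open scoped NNReal ENNReal FourierTransform SchwartzMap

noncomputable section

namespace FracCauchy

/-! ### Processes -/

/-- A Lévy process indexed by `[0, ∞)`: it starts at `0`, has stationary independent increments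
and almost surely right-continuous paths with left limits. -/
structure IsLevyProcess {Ω E : Type*} [MeasurableSpace Ω] [NormedAddCommGroup E]
    [MeasurableSpace E] (X : ℝ≥0 → Ω → E) (P : Measure Ω) : Prop where
  measurable : ∀ t, Measurable (X t)
  zero : ∀ᵐ ω ∂P, X 0 ω = 0
  indep : HasIndepIncrements X P
  stationary : ∀ s t, IdentDistrib (fun ω => X (s + t) ω - X s ω) (X t) P P
  cadlag : ∀ᵐ ω ∂P, ∀ t, ContinuousWithinAt (fun s => X s ω) (Ici t) t ∧
    ∃ l, Tendsto (fun s => X s ω) (𝓝[<] t) (𝓝 l)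

/-- The stable subordinator of order `γ ∈ (0, 1]`: the nondecreasing Lévy process with
`E exp (-μ H(t)) = exp (-t μ ^ γ)`. For `γ = 1` this forces `H(t) = t`. -/
structure IsStableSubordinator {Ω : Type*} [MeasurableSpace Ω] (γ : ℝ) (H : ℝ≥0 → Ω → ℝ)
    (P : Measure Ω) : Prop where
  levy : IsLevyProcess H P
  monotone : ∀ᵐ ω ∂P, Monotone (fun t => H t ω)
  laplace : ∀ (t : ℝ≥0) (μ : ℝ), 0 < μ →
    ∫ ω, Real.exp (-(μ * H t ω)) ∂P = Real.exp (-((t : ℝ) * μ ^ γ))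

/-- The isotropic `2β`-stable process in `ℝⁿ`: the Lévy process with
`E exp (i ξ · S(t)) = exp (-t ‖ξ‖ ^ (2β))`. -/
structure IsIsotropicStable {Ω : Type*} [MeasurableSpace Ω] {n : ℕ} (β : ℝ)
    (S : ℝ≥0 → Ω → EuclideanSpace ℝ (Fin n)) (P : Measure Ω) : Prop where
  levy : IsLevyProcess S P
  charFun_eq : ∀ (t : ℝ≥0) (ξ : EuclideanSpace ℝ (Fin n)),
    charFun (P.map (S t)) ξ = Complex.exp (-(((t : ℝ) * ‖ξ‖ ^ (2 * β) : ℝ) : ℂ))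

/-- `H₁(s) + (2λ)^(1/ν) H₂(s)`. -/
def combinedSubordinator {Ω : Type*} (lam ν : ℝ) (H₁ H₂ : ℝ≥0 → Ω → ℝ) (s : ℝ≥0) (ω : Ω) : ℝ :=
  H₁ s ω + (2 * lam) ^ (1 / ν) * H₂ s ω

/-- The inverse (first passage time) `L(t) = inf {s > 0 : H(s) > t}`. -/
def inverseProcess {Ω : Type*} (H : ℝ≥0 → Ω → ℝ) (t : ℝ) (ω : Ω) : ℝ≥0 :=
  sInf {s : ℝ≥0 | 0 < s ∧ t < H s ω}

/-- `W(t) = S(c² L(t))`, where `L` is the inverse of `H₁ + (2λ)^(1/ν) H₂`. -/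
def composedProcess {Ω E : Type*} (c lam ν : ℝ) (S : ℝ≥0 → Ω → E) (H₁ H₂ : ℝ≥0 → Ω → ℝ)
    (t : ℝ) (ω : Ω) : E :=
  S (Real.toNNReal (c ^ 2) * inverseProcess (combinedSubordinator lam ν H₁ H₂) t ω) ω

/-! ### Fractional operators -/

/-- The functions `u` on `[0, ∞)` whose Caputo derivative of order `γ ∈ (0, 1]` makes sense at
every `t > 0`: continuous on `[0, ∞)`, differentiable on `(0, ∞)`, with `u'` integrable on every
`(0, t)`, also against the Caputo kernel `(t - s)^(-γ)` when `γ < 1`. -/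
structure HasCaputoDeriv (γ : ℝ) (u : ℝ → ℂ) : Prop where
  continuousOn : ContinuousOn u (Ici 0)
  differentiableAt : ∀ t, 0 < t → DifferentiableAt ℝ u t
  integrable : ∀ t, 0 < t → IntervalIntegrable (deriv u) volume 0 t
  integrable_kernel : γ < 1 → ∀ t, 0 < t →
    IntervalIntegrable (fun s => (t - s) ^ (-γ) • deriv u s) volume 0 t

/-- The Caputo derivative of order `γ ∈ (0, 1]` at `t > 0`,
`(1 / Γ(1 - γ)) ∫₀ᵗ u'(s) (t - s)^(-γ) ds` for `γ < 1` and `u'(t)` for `γ = 1`. -/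
def caputoDeriv (γ : ℝ) (u : ℝ → ℂ) (t : ℝ) : ℂ :=
  if γ = 1 then deriv u t
  else (1 / Real.Gamma (1 - γ)) • ∫ s in (0 : ℝ)..t, (t - s) ^ (-γ) • deriv u s

/-- The fractional Laplacian `(-Δ)^β φ`, the operator with Fourier symbol `‖ξ‖ ^ (2β)`. Mathlib's
Fourier transform uses the character `exp (-2πi x · ξ)`, whence the factor `2π`. -/
def fracLaplacian {n : ℕ} (β : ℝ) (φ : EuclideanSpace ℝ (Fin n) → ℂ) :
    EuclideanSpace ℝ (Fin n) → ℂ :=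
  𝓕⁻ (fun ξ : EuclideanSpace ℝ (Fin n) => (2 * Real.pi * ‖ξ‖) ^ (2 * β) • 𝓕 φ ξ)

/-! ### The Cauchy problem -/

/-- The pairing `⟨w, φ⟩ = ∫ φ dw` of a finite signed measure with a function. -/
def pairing {E : Type*} [MeasurableSpace E] (w : SignedMeasure E) (φ : E → ℂ) : ℂ :=
  ∫ᵛ x, φ x ∂<•w

/-- `w = (w t)`, `t ≥ 0`, is a solution of
`(∂ᵗ^α + 2λ ∂ᵗ^ν) w = -c² (-Δ)^β w` for `t > 0`, `w 0 = δ₀`, with Caputo derivatives in time.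
The unknown is a family of finite signed measures on `ℝⁿ`, of total variation bounded on bounded
time intervals. The space variable is treated in the sense of distributions: the equation is
tested with Schwartz functions `φ`, and `(-Δ)^β` (which is symmetric) is moved onto `φ`. The time
derivatives and the equation are understood pointwise, at every `t > 0`, and the initial datum is
attained continuously (continuity of `t ↦ ⟨w t, φ⟩` on `[0, ∞)`). Values of `w` at negative times
play no role. -/
structure IsSolution {n : ℕ} (α ν β c lam : ℝ)
    (w : ℝ → SignedMeasure (EuclideanSpace ℝ (Fin n))) : Prop where
  bounded : ∀ T : ℝ, ∃ M : ℝ≥0, ∀ t, 0 ≤ t → t ≤ T → (w t).variation univ ≤ M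
  initial : w 0 = (Measure.dirac (0 : EuclideanSpace ℝ (Fin n))).toSignedMeasure
  regular_left : ∀ φ : 𝓢(EuclideanSpace ℝ (Fin n), ℂ),
    HasCaputoDeriv α (fun t => pairing (w t) φ)
  regular_right : ∀ φ : 𝓢(EuclideanSpace ℝ (Fin n), ℂ),
    HasCaputoDeriv ν (fun t => pairing (w t) φ)
  equation : ∀ φ : 𝓢(EuclideanSpace ℝ (Fin n), ℂ), ∀ t, 0 < t →
    caputoDeriv α (fun s => pairing (w s) φ) t
      + 2 * (lam : ℂ) * caputoDeriv ν (fun s => pairing (w s) φ) t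
      = -((c : ℂ) ^ 2) * pairing (w t) (fracLaplacian β φ)

end FracCauchy

end

/-! Everything is reduced to scalar relaxation equations, one for each frequency ξ. Put a = 2λ, ψ(x)
= x^α + a x^ν and κ = c²‖ξ‖^(2β). The combined subordinator H has Laplace exponent ψ, because the
factor (2λ)^(1/ν) turns x^ν into 2λ x^ν. Let U be its κ-potential, the measure with Laplace
transform 1/(κ + ψ). Since {L(t) > s} and {H(s) ≤ t} agree up to null sets for almost every s, E
exp(-κ L(t)) = 1 - κ U[0, t] (`integral_exp_inverseProcess`). Subordination shows that this is the
characteristic function of W(t) at ξ.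

The operator ∂^α + a ∂^ν is convolution of u' with a memory kernel K whose Laplace transform is
ψ(x)/x. Hence K ∗ U + κ (1 ∗ U) = 1 (`IsPotential.memoryKernel_conv`), which is the equation for m =
1 - κ U[0, ·] once U is known to have a good density. Differentiating the Laplace transform of U
gives t U(dt) = K' ∗ U ∗ U, where K' has transform ψ'. As α, ν ≤ 1, K' ≤ K, so K' ∗ U lies below
Lebesgue measure. Therefore U has a density r, continuous on (0, ∞), with κ r(t) ≤ 1/t for all κ
(`IsPotential.exists_isPotentialDensity`). This bound, uniform in κ, allows differentiation under
the integral u_φ(t) = ∫ 𝓕φ(ξ) m(ξ, t) dξ, and Fubini gives existence (`isSolution_of_charFun`).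

For uniqueness, the equation tested with φ is convolved with the same potential U
(`IsPotential.integral_caputoDeriv`), and φ tends boundedly to the character exp(i x · ξ), together
with its fractional Laplacian. With κ the symbol at ξ, the unknown integrals cancel and leave the
Fourier transform of w_T equal to 1 - κ U[0, T) (`IsSolution.pairing_character`). A finite signed
measure is determined by its Fourier transform. -/

namespace FracCauchy

/-! ### Laplace transforms of measures on the half-line. -/

/-- The Laplace transform `∫ exp (-x t) dA(t)` of a measure on the line. -/
noncomputable def laplace (A : Measure ℝ) (x : ℝ) : ℝ≥0∞ :=
  ∫⁻ t, ENNReal.ofReal (Real.exp (-(x * t))) ∂A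

lemma laplace_add (A B : Measure ℝ) (x : ℝ) : laplace (A + B) x = laplace A x + laplace B x := by
  simp [laplace, lintegral_add_measure]

lemma laplace_smul (a : ℝ≥0∞) (A : Measure ℝ) (x : ℝ) :
    laplace (a • A) x = a * laplace A x := by
  simp [laplace, lintegral_smul_measure]

lemma laplace_conv (A B : Measure ℝ) [SFinite A] [SFinite B] (x : ℝ) :
    laplace (A ∗ B) x = laplace A x * laplace B x := by
  unfold laplace
  rw [Measure.lintegral_conv (by fun_prop)]
  simp_rw [mul_add, neg_add, Real.exp_add, ENNReal.ofReal_mul (Real.exp_nonneg _)]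
  simp_rw [lintegral_const_mul _ (f := fun t => ENNReal.ofReal (Real.exp (-(x * t))))
    (by fun_prop)]
  rw [lintegral_mul_const _ (by fun_prop)]

/-- The exponential weight makes the measure finite, and dividing by the weight again preserves
s-finiteness. Convolutions with potentials rely on this. -/
lemma sFinite_of_laplace_ne_top {A : Measure ℝ} {x : ℝ} (h : laplace A x ≠ ∞) : SFinite A := by
  have hfin : IsFiniteMeasure (A.withDensity fun t => ENNReal.ofReal (Real.exp (-(x * t)))) :=
    isFiniteMeasure_withDensity h
  have := withDensity_inv_same (μ := A) (f := fun t => ENNReal.ofReal (Real.exp (-(x * t))))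
    (by fun_prop) (by simp [Real.exp_pos]) (by simp)
  rw [← this]
  infer_instance

lemma ae_nonneg_of_Iio {A : Measure ℝ} (hA : A (Iio 0) = 0) : ∀ᵐ t ∂A, 0 ≤ t :=
  ae_iff.2 (by simp only [not_le]; exact hA)

/-- A finite measure on `[0, 1]` is determined by its moments. -/
lemma ext_of_moments {A B : Measure ℝ} [IsFiniteMeasure A] [IsFiniteMeasure B]
    (hA : ∀ᵐ y ∂A, y ∈ Icc (0 : ℝ) 1) (hB : ∀ᵐ y ∂B, y ∈ Icc (0 : ℝ) 1)
    (h : ∀ k : ℕ, ∫ y, y ^ k ∂A = ∫ y, y ^ k ∂B) : A = B := by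
  have hint : ∀ (C : Measure ℝ) [IsFiniteMeasure C], (∀ᵐ y ∂C, y ∈ Icc (0 : ℝ) 1) →
      ∀ p : Polynomial ℝ, Integrable (fun y => p.eval y) C := by
    intro C _ hC p
    obtain ⟨M, hM⟩ := isCompact_Icc.exists_bound_of_continuousOn
      (s := Icc (0 : ℝ) 1) (f := fun y => p.eval y) p.continuous.continuousOn
    exact Integrable.of_bound p.continuous.aestronglyMeasurable M (hC.mono fun y hy => hM y hy)
  have hpow : ∀ (C : Measure ℝ) [IsFiniteMeasure C], (∀ᵐ y ∂C, y ∈ Icc (0 : ℝ) 1) →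
      ∀ k : ℕ, Integrable (fun y => y ^ k) C := by
    intro C _ hC k
    simpa using hint C hC (Polynomial.X ^ k)
  have hpoly : ∀ p : Polynomial ℝ, ∫ y, p.eval y ∂A = ∫ y, p.eval y ∂B := by
    intro p
    simp_rw [Polynomial.eval_eq_sum_range]
    rw [integral_finsetSum _ fun i _ => (hpow A hA i).const_mul _,
      integral_finsetSum _ fun i _ => (hpow B hB i).const_mul _]
    simp_rw [integral_const_mul, h]
  refine ext_of_forall_integral_eq_of_IsFiniteMeasure fun f => ?_
  refine eq_of_forall_dist_le fun ε hε => ?_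
  -- The summand 1 keeps M positive even when both measures vanish.
  set M := A.real univ + B.real univ + 1 with hM
  have hMpos : 0 < M := by positivity
  obtain ⟨p, hp⟩ := exists_polynomial_near_of_continuousOn 0 1 f f.continuous.continuousOn
    (ε / M) (by positivity)
  have hclose : ∀ (C : Measure ℝ) [IsFiniteMeasure C], (∀ᵐ y ∂C, y ∈ Icc (0 : ℝ) 1) →
      |∫ y, f y ∂C - ∫ y, p.eval y ∂C| ≤ ε / M * C.real univ := by
    intro C _ hC
    rw [← integral_sub (f.integrable C) (hint C hC p), ← Real.norm_eq_abs]
    refine norm_integral_le_of_norm_le_const (hC.mono fun y hy => ?_)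
    rw [Real.norm_eq_abs, abs_sub_comm]
    exact (hp y hy).le
  have h1 := hclose A hA
  have h2 := hclose B hB
  rw [hpoly p] at h1
  rw [Real.dist_eq]
  calc |∫ y, f y ∂A - ∫ y, f y ∂B|
      ≤ ε / M * A.real univ + ε / M * B.real univ := by
        rw [abs_le] at h1 h2 ⊢
        constructor <;> linarith [h1.1, h1.2, h2.1, h2.2]
    _ = ε * ((A.real univ + B.real univ) / M) := by ring
    _ ≤ ε * 1 := by
        gcongr
        rw [div_le_one hMpos, hM]; linarith
    _ = ε := mul_one _

/-- Measures on `[0, ∞)` with finite Laplace transforms are determined by them. -/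
theorem ext_of_laplace {A B : Measure ℝ} (hA : A (Iio 0) = 0) (hB : B (Iio 0) = 0)
    (hfin : ∀ x, 0 < x → laplace A x ≠ ∞) (h : ∀ x, 0 < x → laplace A x = laplace B x) :
    A = B := by
  -- Weighting by exp(-t) and pushing forward along t ↦ exp(-t) gives finite measures on [0, 1]
  -- whose k-th moments are the Laplace transforms at k + 1.
  set f : ℝ → ℝ≥0∞ := fun t => ENNReal.ofReal (Real.exp (-(1 * t))) with hf
  have hfm : Measurable f := by fun_prop
  have hmap : (A.withDensity f).map (fun t => Real.exp (-t))
      = (B.withDensity f).map (fun t => Real.exp (-t)) := by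
    have hfA : IsFiniteMeasure (A.withDensity f) :=
      isFiniteMeasure_withDensity (hfin 1 one_pos)
    have hfB : IsFiniteMeasure (B.withDensity f) :=
      isFiniteMeasure_withDensity (by have := hfin 1 one_pos; rwa [h 1 one_pos] at this)
    have hsupp : ∀ C : Measure ℝ, C (Iio 0) = 0 →
        ∀ᵐ y ∂(C.withDensity f).map (fun t => Real.exp (-t)), y ∈ Icc (0 : ℝ) 1 := by
      intro C hC
      refine (ae_map_iff (f := fun t : ℝ => Real.exp (-t)) (by fun_prop) measurableSet_Icc).2 ?_
      refine (withDensity_absolutelyContinuous C f).ae_le ?_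
      filter_upwards [ae_nonneg_of_Iio hC] with t ht
      exact ⟨(Real.exp_pos _).le, Real.exp_le_one_iff.2 (by linarith)⟩
    have hmom : ∀ C : Measure ℝ, ∀ k : ℕ,
        ∫ y, y ^ k ∂(C.withDensity f).map (fun t => Real.exp (-t))
          = (laplace C (k + 1)).toReal := by
      intro C k
      rw [integral_map (by fun_prop) (by fun_prop), integral_eq_lintegral_of_nonneg_ae
        (ae_of_all _ fun t => by positivity) (by fun_prop),
        lintegral_withDensity_eq_lintegral_mul _ hfm (by fun_prop)]
      congr 1
      refine lintegral_congr fun t => ?_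
      rw [hf, Pi.mul_apply, ← ENNReal.ofReal_mul (Real.exp_nonneg _), ← Real.exp_nat_mul,
        ← Real.exp_add]
      congr 2
      ring
    refine ext_of_moments (hsupp A hA) (hsupp B hB) fun k => ?_
    rw [hmom, hmom, h _ (by positivity)]
  have hback : ∀ C : Measure ℝ,
      ((C.withDensity f).map (fun t => Real.exp (-t))).map (fun y => -Real.log y)
        = C.withDensity f := by
    intro C
    rw [Measure.map_map (by fun_prop) (by fun_prop)]
    convert Measure.map_id using 2
    ext t
    simp
  have hd : A.withDensity f = B.withDensity f := by rw [← hback A, hmap, hback B]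
  have hinv : ∀ C : Measure ℝ, (C.withDensity f).withDensity f⁻¹ = C := fun C =>
    withDensity_inv_same hfm (by simp [hf, Real.exp_pos]) (by simp [hf])
  rw [← hinv A, hd, hinv B]

/-! ### Caputo kernels as measures. -/

/-- The measure on `[0, ∞)` against which `u'(t - ·)` is integrated in the Caputo derivative. -/
noncomputable def caputoKernel (γ : ℝ) : Measure ℝ :=
  if γ = 1 then Measure.dirac 0
  else (volume.restrict (Ioi 0)).withDensity
    fun t => ENNReal.ofReal (1 / Real.Gamma (1 - γ) * t ^ (-γ))

instance (γ : ℝ) : SFinite (caputoKernel γ) := by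
  unfold caputoKernel; split_ifs <;> infer_instance

lemma volume_Ioi_Iio : (volume.restrict (Ioi (0 : ℝ))) (Iio 0) = 0 := by
  rw [Measure.restrict_apply measurableSet_Iio]
  convert measure_empty (μ := (volume : Measure ℝ))
  ext x; simp; intro h; exact h.le

lemma caputoKernel_Iio (γ : ℝ) : caputoKernel γ (Iio 0) = 0 := by
  unfold caputoKernel; split_ifs
  · simp
  · exact withDensity_absolutelyContinuous _ _ volume_Ioi_Iio

lemma lintegral_rpow_mul_exp {a x : ℝ} (ha : 0 < a) (hx : 0 < x) :
    ∫⁻ t in Ioi (0 : ℝ), ENNReal.ofReal (t ^ (a - 1)) * ENNReal.ofReal (Real.exp (-(x * t)))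
      = ENNReal.ofReal ((1 / x) ^ a * Real.Gamma a) := by
  rw [← Real.integral_rpow_mul_exp_neg_mul_Ioi ha hx, ofReal_integral_eq_lintegral_ofReal]
  · refine setLIntegral_congr_fun measurableSet_Ioi fun t ht => ?_
    rw [ENNReal.ofReal_mul (Real.rpow_nonneg (le_of_lt ht) _)]
  · have h := Real.integral_rpow_mul_exp_neg_mul_Ioi ha hx
    -- A non-integrable function has Bochner integral 0, but the Gamma integral is positive.
    by_contra hc
    rw [integral_undef hc] at h
    have := Real.Gamma_pos_of_pos ha
    have : 0 < (1 / x) ^ a * Real.Gamma a := by positivity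
    linarith
  · refine (ae_restrict_iff' measurableSet_Ioi).2 (ae_of_all _ fun t ht => ?_)
    have : 0 ≤ t ^ (a - 1) := Real.rpow_nonneg (le_of_lt ht) _
    positivity

lemma laplace_caputoKernel {γ x : ℝ} (hγ : γ ≤ 1) (hx : 0 < x) :
    laplace (caputoKernel γ) x = ENNReal.ofReal (x ^ (γ - 1)) := by
  unfold caputoKernel laplace
  split_ifs with h
  · simp [h]
  · have hγ' : 0 < 1 - γ := sub_pos.2 (lt_of_le_of_ne hγ h)
    have hG := Real.Gamma_pos_of_pos hγ'
    rw [lintegral_withDensity_eq_lintegral_mul _ (by fun_prop) (by fun_prop)]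
    simp only [Pi.mul_apply, ENNReal.ofReal_mul (one_div_pos.2 hG).le, mul_assoc]
    rw [lintegral_const_mul _ (by fun_prop)]
    have := lintegral_rpow_mul_exp hγ' hx
    rw [show 1 - γ - 1 = -γ by ring] at this
    rw [this, ← ENNReal.ofReal_mul (one_div_pos.2 hG).le]
    congr 1
    rw [one_div x, Real.inv_rpow hx.le, ← Real.rpow_neg hx.le, neg_sub]
    field_simp

lemma laplace_halfLine {x : ℝ} (hx : 0 < x) :
    laplace (volume.restrict (Ioi 0)) x = ENNReal.ofReal x⁻¹ := by
  have := lintegral_rpow_mul_exp one_pos hx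
  simpa [laplace] using this

/-! ### Convolutions on the half-line and their continuity. -/

lemma conv_mono_left {A A' B : Measure ℝ} [SFinite B] (h : A ≤ A') : A ∗ B ≤ A' ∗ B := by
  refine Measure.le_iff.2 fun s hs => ?_
  rw [← lintegral_indicator_one hs, ← lintegral_indicator_one hs,
    Measure.lintegral_conv (by measurability), Measure.lintegral_conv (by measurability)]
  exact lintegral_mono' h le_rfl

lemma conv_Iio {A B : Measure ℝ} [SFinite A] [SFinite B] (hA : A (Iio 0) = 0)
    (hB : B (Iio 0) = 0) : (A ∗ B) (Iio 0) = 0 := by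
  rw [← lintegral_indicator_one measurableSet_Iio, Measure.lintegral_conv (by measurability)]
  refine (lintegral_congr_ae ?_).trans lintegral_zero
  filter_upwards [ae_nonneg_of_Iio hA] with s hs
  refine (lintegral_congr_ae ?_).trans lintegral_zero
  filter_upwards [ae_nonneg_of_Iio hB] with t ht
  simp [add_nonneg hs ht]

/-- Convolving with an absolutely continuous measure. -/
lemma withDensity_conv {q : ℝ → ℝ≥0∞} (hq : Measurable q) (B : Measure ℝ) [SFinite B] :
    volume.withDensity q ∗ B = volume.withDensity fun t => ∫⁻ s, q (t - s) ∂B := by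
  refine Measure.ext_of_lintegral _ fun φ hφ => ?_
  have h1 : ∀ x, Measurable fun s => φ (x + s) := fun x => by fun_prop
  have h2 : ∀ x, Measurable fun s => q (x - s) := fun x => by fun_prop
  rw [Measure.lintegral_conv hφ, lintegral_withDensity_eq_lintegral_mul _ hq (by fun_prop),
    lintegral_withDensity_eq_lintegral_mul _ (by fun_prop) hφ]
  simp only [Pi.mul_apply, ← lintegral_const_mul _ (h1 _), ← lintegral_mul_const _ (h2 _)]
  rw [lintegral_lintegral_swap (f := fun t s => q t * φ (t + s)) (by fun_prop),
    lintegral_lintegral_swap (f := fun t s => q (t - s) * φ t) (by fun_prop)]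
  refine lintegral_congr fun s => ?_
  rw [← lintegral_sub_right_eq_self (fun t => q t * φ (t + s)) s]
  simp

/-- The convolution of an integrable function and a bounded measurable function is continuous. -/
lemma continuous_integral_mul_of_bounded {f q : ℝ → ℝ} (hf : Integrable f) (hq : Measurable q)
    {M : ℝ} (hM : ∀ x, |q x| ≤ M) : Continuous fun t => ∫ s, f s * q (t - s) := by
  have hM0 : 0 ≤ M := (abs_nonneg _).trans (hM 0)
  have hint : ∀ {f : ℝ → ℝ}, Integrable f → ∀ t, Integrable fun s => f s * q (t - s) := by
    intro f hf t
    refine hf.mul_bdd (c := M) (Measurable.aestronglyMeasurable (by fun_prop)) (ae_of_all _ fun s => hM _)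
  refine continuous_of_uniform_approx_of_continuous fun u hu => ?_
  obtain ⟨ε, hε, hεu⟩ := Metric.mem_uniformity_dist.1 hu
  -- Replacing f by g changes the convolution by at most M‖f - g‖₁, uniformly in t. The denominator
  -- uses M + 1 because M may be 0.
  obtain ⟨g, hgc, hg, hgcont, hgi⟩ := hf.exists_hasCompactSupport_integral_sub_le
    (ε := ε / (2 * (M + 1))) (by positivity)
  refine ⟨fun t => ∫ s, g s * q (t - s), ?_, fun t => hεu ?_⟩
  · have hloc : LocallyIntegrable q := by
      refine (locallyIntegrable_const M).mono hq.aestronglyMeasurable (ae_of_all _ fun x => ?_)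
      simpa [abs_of_nonneg hM0] using hM x
    exact hgc.continuous_convolution_left (ContinuousLinearMap.mul ℝ ℝ) hgcont hloc
  · rw [dist_eq_norm, ← integral_sub (hint hf t) (hint hgi t)]
    calc ‖∫ s, f s * q (t - s) - g s * q (t - s)‖
        ≤ ∫ s, ‖f s - g s‖ * M := by
          refine norm_integral_le_of_norm_le ((hf.sub hgi).norm.mul_const _) (ae_of_all _ fun s => ?_)
          rw [← sub_mul, norm_mul]
          exact mul_le_mul_of_nonneg_left (hM _) (norm_nonneg _)
      _ = (∫ s, ‖f s - g s‖) * M := integral_mul_const _ _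
      _ ≤ ε / (2 * (M + 1)) * M := by gcongr
      _ < ε := by
          rw [div_mul_eq_mul_div, div_lt_iff₀ (by positivity)]
          nlinarith

/-- The convolution of two locally integrable functions on `[0, ∞)`, both continuous on `(0, ∞)`,
exists and is continuous on `(0, ∞)`. -/
lemma continuousOn_convolution_halfLine {k r : ℝ → ℝ} (hk : Measurable k) (hr : Measurable r)
    (hkc : ContinuousOn k (Ioi 0)) (hrc : ContinuousOn r (Ioi 0))
    (hk0 : ∀ t ≤ 0, k t = 0) (hr0 : ∀ t ≤ 0, r t = 0)
    (hki : ∀ T, IntegrableOn k (Iic T)) (hri : ∀ T, IntegrableOn r (Iic T)) :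
    (∀ t, 0 < t → Integrable fun s => k s * r (t - s)) ∧
      ContinuousOn (fun t => ∫ s, k s * r (t - s)) (Ioi 0) := by
  have key : ∀ t₀, 0 < t₀ → (Integrable fun s => k s * r (t₀ - s)) ∧
      ContinuousAt (fun t => ∫ s, k s * r (t - s)) t₀ := by
    intro t₀ ht₀
    -- For t > 2δ the conditions s ≤ δ and t - s ≤ δ exclude each other. So in each piece of the
    -- product one factor lives on (δ, T], where it is bounded, and the other is integrable.
    set δ := t₀ / 3 with hδ
    set T := 2 * t₀ with hT
    have hbd : ∀ {f : ℝ → ℝ}, ContinuousOn f (Ioi 0) →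
        ∃ M, ∀ x, |(Ioc δ T).indicator f x| ≤ M := by
      intro f hf
      obtain ⟨M, hM⟩ := isCompact_Icc.exists_bound_of_continuousOn
        (hf.mono (fun x (hx : x ∈ Icc δ T) => lt_of_lt_of_le (by positivity : 0 < δ) hx.1))
      refine ⟨max M 0, fun x => ?_⟩
      by_cases hx : x ∈ Ioc δ T
      · rw [indicator_of_mem hx]
        exact (hM x (Ioc_subset_Icc_self hx)).trans (le_max_left _ _)
      · rw [indicator_of_notMem hx]
        simp
    obtain ⟨Mk, hMk⟩ := hbd hkc
    obtain ⟨Mr, hMr⟩ := hbd hrc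
    set k₁ := (Iic δ).indicator k
    set k₂ := (Ioc δ T).indicator k
    set r₁ := (Iic δ).indicator r
    set r₂ := (Ioc δ T).indicator r
    have hk₁ : Integrable k₁ := (hki δ).integrable_indicator measurableSet_Iic
    have hr₁ : Integrable r₁ := (hri δ).integrable_indicator measurableSet_Iic
    have hk₂ : Integrable k₂ := ((hki T).mono_set Ioc_subset_Iic_self).integrable_indicator
      measurableSet_Ioc
    have hk₂m : Measurable k₂ := hk.indicator measurableSet_Ioc
    have hr₂m : Measurable r₂ := hr.indicator measurableSet_Ioc
    have hsplit : ∀ t ∈ Ioo (2 * δ) T, ∀ s,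
        k s * r (t - s) = k₁ s * r₂ (t - s) + r₁ (t - s) * k₂ (t - (t - s))
          + k₂ s * r₂ (t - s) := by
      intro t ht s
      have h2 := ht.1
      have h3 := ht.2
      rw [sub_sub_cancel]
      simp only [k₁, k₂, r₁, r₂, indicator, mem_Iic, mem_Ioc]
      rcases le_or_gt s 0 with hs | hs
      · simp [hk0 s hs]
      rcases le_or_gt (t - s) 0 with hs' | hs'
      · simp [hr0 _ hs']
      by_cases h4 : s ≤ δ <;> by_cases h5 : t - s ≤ δ
      · linarith
      · simp [h4, not_lt.2 h4, h5, not_le.1 h5, (by linarith : t - s ≤ T)]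
      · simp [h4, not_le.1 h4, h5, not_lt.2 h5, (by linarith : s ≤ T), mul_comm]
      · simp [h4, not_le.1 h4, h5, not_le.1 h5, (by linarith : s ≤ T), (by linarith : t - s ≤ T)]
    have hi : ∀ t, (Integrable fun s => k₁ s * r₂ (t - s)) ∧
        (Integrable fun s => r₁ (t - s) * k₂ (t - (t - s))) ∧
        Integrable fun s => k₂ s * r₂ (t - s) := by
      intro t
      refine ⟨hk₁.mul_bdd (c := Mr) (Measurable.aestronglyMeasurable (by fun_prop)) (ae_of_all _ fun s => hMr _), ?_,
        hk₂.mul_bdd (c := Mr) (Measurable.aestronglyMeasurable (by fun_prop)) (ae_of_all _ fun s => hMr _)⟩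
      exact (hr₁.comp_sub_left t).mul_bdd (c := Mk)
        (Measurable.aestronglyMeasurable (by fun_prop)) (ae_of_all _ fun s => hMk _)
    have hmem : t₀ ∈ Ioo (2 * δ) T := ⟨by rw [hδ]; linarith, by rw [hT]; linarith⟩
    have hfun : ∀ t ∈ Ioo (2 * δ) T, (fun s => k s * r (t - s)) = fun s =>
        k₁ s * r₂ (t - s) + r₁ (t - s) * k₂ (t - (t - s)) + k₂ s * r₂ (t - s) :=
      fun t ht => funext (hsplit t ht)
    constructor
    · rw [hfun t₀ hmem]
      exact ((hi t₀).1.add (hi t₀).2.1).add (hi t₀).2.2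
    · have hcont : Continuous fun t => (∫ s, k₁ s * r₂ (t - s)) + (∫ s, r₁ s * k₂ (t - s))
          + ∫ s, k₂ s * r₂ (t - s) :=
        ((continuous_integral_mul_of_bounded hk₁ hr₂m hMr).add
          (continuous_integral_mul_of_bounded hr₁ hk₂m hMk)).add
          (continuous_integral_mul_of_bounded hk₂ hr₂m hMr)
      refine hcont.continuousAt.congr ?_
      filter_upwards [isOpen_Ioo.mem_nhds hmem] with t ht
      have h12 : Integrable fun s => k₁ s * r₂ (t - s) + r₁ (t - s) * k₂ (t - (t - s)) :=
        (hi t).1.add (hi t).2.1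
      rw [hfun t ht, integral_add h12 (hi t).2.2, integral_add (hi t).1 (hi t).2.1,
        integral_sub_left_eq_self (fun s => r₁ s * k₂ (t - s)) volume t]
  exact ⟨fun t ht => (key t ht).1, fun t ht => (key t ht).2.continuousWithinAt⟩

/-! ### Potentials and their resolvent equation. -/

/-- The Laplace exponent `x ^ α + a x ^ ν` of the combined subordinator. -/
noncomputable def symbol (α ν a x : ℝ) : ℝ := x ^ α + a * x ^ ν

lemma symbol_pos {α ν a x : ℝ} (ha : 0 < a) (hx : 0 < x) : 0 < symbol α ν a x := by
  unfold symbol; positivity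

/-- The memory kernel of the operator `∂ᵗ^α + a ∂ᵗ^ν`. -/
noncomputable def memoryKernel (α ν a : ℝ) : Measure ℝ :=
  caputoKernel α + ENNReal.ofReal a • caputoKernel ν

instance (α ν a : ℝ) : SFinite (memoryKernel α ν a) := by
  unfold memoryKernel; infer_instance

/-- The `κ`-potential of the combined subordinator, characterised by its Laplace transform. -/
structure IsPotential (α ν a κ : ℝ) (U : Measure ℝ) : Prop where
  measure_Iio : U (Iio 0) = 0
  laplace_eq : ∀ x, 0 < x → laplace U x = ENNReal.ofReal (κ + symbol α ν a x)⁻¹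

namespace IsPotential

variable {α ν a κ : ℝ} {U : Measure ℝ}

lemma sFinite (hU : IsPotential α ν a κ U) : SFinite U :=
  sFinite_of_laplace_ne_top (x := 1) (by rw [hU.laplace_eq 1 one_pos]; exact ENNReal.ofReal_ne_top)

/-- The potential is the resolvent of the memory kernel. -/
lemma memoryKernel_conv (hU : IsPotential α ν a κ U) (hα : α ≤ 1) (hν : ν ≤ 1) (ha : 0 < a)
    (hκ : 0 ≤ κ) :
    memoryKernel α ν a ∗ U + ENNReal.ofReal κ • (volume.restrict (Ioi 0) ∗ U)
      = volume.restrict (Ioi 0) := by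
  have := hU.sFinite
  have hmem : memoryKernel α ν a (Iio 0) = 0 := by
    simp [memoryKernel, caputoKernel_Iio]
  have hlap : ∀ x, 0 < x → laplace (memoryKernel α ν a ∗ U
      + ENNReal.ofReal κ • (volume.restrict (Ioi 0) ∗ U)) x
      = laplace (volume.restrict (Ioi 0)) x := by
    intro x hx
    have hs := symbol_pos (α := α) (ν := ν) ha hx
    rw [laplace_add, laplace_smul, laplace_conv, laplace_conv, memoryKernel, laplace_add,
      laplace_smul, laplace_caputoKernel hα hx, laplace_caputoKernel hν hx, laplace_halfLine hx,
      hU.laplace_eq x hx, ← ENNReal.ofReal_mul ha.le, ← ENNReal.ofReal_add (by positivity)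
      (by positivity), ← ENNReal.ofReal_mul (by positivity), ← ENNReal.ofReal_mul (by positivity),
      ← ENNReal.ofReal_mul hκ, ← ENNReal.ofReal_add (by positivity) (by positivity)]
    congr 1
    -- The memory kernel has transform ψ(x)/x, so the claim becomes (ψ/x + κ/x)/(κ + ψ) = 1/x.
    have h1 : x ^ (α - 1) + a * x ^ (ν - 1) = symbol α ν a x * x⁻¹ := by
      rw [symbol, Real.rpow_sub_one hx.ne', Real.rpow_sub_one hx.ne']
      ring
    rw [h1]
    field_simp
    ring
  refine ext_of_laplace ?_ volume_Ioi_Iio (fun x hx => ?_) hlap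
  · simp [conv_Iio hmem hU.measure_Iio, conv_Iio volume_Ioi_Iio hU.measure_Iio]
  · rw [hlap x hx, laplace_halfLine hx]
    exact ENNReal.ofReal_ne_top

/-- Multiplication by t is minus differentiation of the Laplace transform, here that of (κ + ψ)⁻¹.
The transform at x is read as the moment generating function of `id` at -x, which is differentiable
in the interior of its integrability set. -/
lemma laplace_withDensity_id (hU : IsPotential α ν a κ U) (ha : 0 < a) (hκ : 0 ≤ κ) {x : ℝ}
    (hx : 0 < x) :
    laplace (U.withDensity fun t => ENNReal.ofReal t) x
      = ENNReal.ofReal ((α * x ^ (α - 1) + a * (ν * x ^ (ν - 1)))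
          / (κ + symbol α ν a x) ^ 2) := by
  have hmgf : ∀ s < 0, mgf id U s = (κ + symbol α ν a (-s))⁻¹ := by
    intro s hs
    have h := hU.laplace_eq (-s) (by linarith)
    have hp := symbol_pos (α := α) (ν := ν) ha (neg_pos.2 hs)
    rw [mgf, integral_eq_lintegral_of_nonneg_ae (ae_of_all _ fun _ => by positivity)
      (by fun_prop)]
    simp only [laplace, neg_mul, neg_neg] at h
    simp only [id, h]
    exact ENNReal.toReal_ofReal (by positivity)
  have hset : Iio (0 : ℝ) ⊆ integrableExpSet id U := by
    intro s hs
    have hp := symbol_pos (α := α) (ν := ν) ha (neg_pos.2 hs)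
    -- Integrability follows from the positive value, since a non-integrable exponential would have
    -- integral 0.
    by_contra hc
    have := hmgf s hs
    rw [mgf, integral_undef hc] at this
    have : 0 < (κ + symbol α ν a (-s))⁻¹ := by positivity
    linarith
  have hint : -x ∈ interior (integrableExpSet id U) :=
    interior_maximal hset isOpen_Iio (by simpa using hx)
  have hd := hasDerivAt_mgf hint
  have hs := symbol_pos (α := α) (ν := ν) ha hx
  have hd' : HasDerivAt (mgf id U) ((α * x ^ (α - 1) + a * (ν * x ^ (ν - 1)))
      / (κ + symbol α ν a x) ^ 2) (-x) := by
    have h1 : HasDerivAt (fun y => (κ + symbol α ν a y)⁻¹)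
        (-(α * x ^ (α - 1) + a * (ν * x ^ (ν - 1))) / (κ + symbol α ν a x) ^ 2) x := by
      refine HasDerivAt.fun_inv ?_ (by positivity)
      exact ((Real.hasDerivAt_rpow_const (Or.inl hx.ne')).add
        ((Real.hasDerivAt_rpow_const (Or.inl hx.ne')).const_mul a)).const_add κ
    have h2 : HasDerivAt (fun s : ℝ => (κ + symbol α ν a (-s))⁻¹)
        ((-(α * x ^ (α - 1) + a * (ν * x ^ (ν - 1))) / (κ + symbol α ν a x) ^ 2) * -1) (-x) := by
      rw [← neg_neg x] at h1
      exact (HasDerivAt.comp (-x) h1 (hasDerivAt_neg (-x))).congr_deriv (by simp)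
    refine (h2.congr_of_eventuallyEq ?_).congr_deriv (by ring)
    filter_upwards [Iio_mem_nhds (by linarith : -x < 0)] with s hs
    exact hmgf s hs
  have heq := hd.unique hd'
  have hi := integrable_pow_mul_exp_of_mem_interior_integrableExpSet hint 1
  rw [laplace, lintegral_withDensity_eq_lintegral_mul _ (by fun_prop) (by fun_prop), ← heq,
    ofReal_integral_eq_lintegral_ofReal (by simpa using hi)]
  · refine lintegral_congr_ae ?_
    filter_upwards [ae_nonneg_of_Iio hU.measure_Iio] with t ht
    simp [ENNReal.ofReal_mul ht]
  · filter_upwards [ae_nonneg_of_Iio hU.measure_Iio] with t ht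
    simp only [Pi.zero_apply, id]
    positivity

/-- `t U(dt) = (K' * U) * U` with `K'` the weighted memory kernel: the derivative of the Laplace
transform of `U`. -/
lemma withDensity_id (hU : IsPotential α ν a κ U) (hα : α ∈ Ioc (0 : ℝ) 1)
    (hν : ν ∈ Ioc (0 : ℝ) 1) (ha : 0 < a) (hκ : 0 ≤ κ) :
    U.withDensity (fun t => ENNReal.ofReal t)
      = ((ENNReal.ofReal α • caputoKernel α + ENNReal.ofReal (a * ν) • caputoKernel ν) ∗ U) ∗ U := by
  have := hU.sFinite
  have hα0 := hα.1
  have hν0 := hν.1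
  refine ext_of_laplace ?_ ?_ ?_ ?_
  · exact withDensity_absolutelyContinuous _ _ hU.measure_Iio
  · exact conv_Iio (conv_Iio (by simp [caputoKernel_Iio]) hU.measure_Iio) hU.measure_Iio
  · intro x hx
    rw [hU.laplace_withDensity_id ha hκ hx]
    exact ENNReal.ofReal_ne_top
  · intro x hx
    have hs := symbol_pos (α := α) (ν := ν) ha hx
    rw [hU.laplace_withDensity_id ha hκ hx, laplace_conv, laplace_conv, laplace_add, laplace_smul,
      laplace_smul, laplace_caputoKernel hα.2 hx, laplace_caputoKernel hν.2 hx,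
      hU.laplace_eq x hx, ← ENNReal.ofReal_mul hα0.le, ← ENNReal.ofReal_mul (by positivity),
      ← ENNReal.ofReal_add (by positivity) (by positivity), ← ENNReal.ofReal_mul (by positivity),
      ← ENNReal.ofReal_mul (by positivity)]
    congr 1
    field_simp

/-- Markov's inequality with the weight exp(-t), which is at least exp(-T) on the half-line. -/
lemma measure_Iic_lt_top (hU : IsPotential α ν a κ U) (T : ℝ) : U (Iic T) < ∞ := by
  have h : ENNReal.ofReal (Real.exp (-T)) * U (Iic T) ≤ laplace U 1 := by
    rw [← setLIntegral_const]
    refine (setLIntegral_mono (by fun_prop) fun t ht => ?_).trans (setLIntegral_le_lintegral _ _)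
    exact ENNReal.ofReal_le_ofReal (Real.exp_le_exp.2 (by simpa using ht))
  rw [hU.laplace_eq 1 one_pos] at h
  exact ENNReal.lt_top_of_mul_ne_top_right (h.trans_lt ENNReal.ofReal_lt_top).ne
    (by simp [Real.exp_pos])

/-- An atom at 0 contributes its full mass to the Laplace transform at every x, and that transform
tends to 0 as x → ∞. Without an atom at 0, the density of t U(dt) can be divided by t. -/
lemma measure_singleton_zero (hU : IsPotential α ν a κ U) (hα : 0 < α) (ha : 0 < a)
    (hκ : 0 ≤ κ) : U {0} = 0 := by
  have hle : ∀ x, 0 < x → U {0} ≤ ENNReal.ofReal (x ^ α)⁻¹ := by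
    intro x hx
    calc U {0} = ∫⁻ t in {0}, ENNReal.ofReal (Real.exp (-(x * t))) ∂U := by simp
      _ ≤ laplace U x := setLIntegral_le_lintegral _ _
      _ ≤ ENNReal.ofReal (x ^ α)⁻¹ := by
        rw [hU.laplace_eq x hx]
        refine ENNReal.ofReal_le_ofReal (inv_anti₀ (by positivity) ?_)
        have : 0 ≤ a * x ^ ν := by positivity
        rw [symbol]; linarith
  have hlim : Tendsto (fun x : ℝ => ENNReal.ofReal (x ^ α)⁻¹) atTop (𝓝 0) := by
    have := (ENNReal.continuous_ofReal.tendsto 0).comp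
      (tendsto_inv_atTop_zero.comp (tendsto_rpow_atTop hα))
    simpa [Function.comp_def] using this
  exact le_antisymm (ge_of_tendsto hlim ((eventually_gt_atTop 0).mono hle)) zero_le

end IsPotential

/-! ### The density of the potential. -/

lemma continuous_convolution_of_bounded_halfLine {r q : ℝ → ℝ} (hr : ∀ T, IntegrableOn r (Iic T))
    (hq : Measurable q) (hq0 : ∀ t ≤ 0, q t = 0) {M : ℝ} (hM : ∀ x, |q x| ≤ M) :
    Continuous fun t => ∫ s, r s * q (t - s) := by
  refine continuous_iff_continuousAt.2 fun t₀ => ?_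
  -- As q vanishes on (-∞, 0], for t near t₀ only values of r up to t₀ + 1 enter, so r may be
  -- truncated to an integrable function.
  have hc := continuous_integral_mul_of_bounded
    ((hr (t₀ + 1)).integrable_indicator measurableSet_Iic) hq hM
  refine hc.continuousAt.congr ?_
  filter_upwards [Iio_mem_nhds (by linarith : t₀ < t₀ + 1)] with t ht
  refine integral_congr_ae (ae_of_all _ fun s => ?_)
  by_cases hs : s ∈ Iic (t₀ + 1)
  · simp [indicator_of_mem hs]
  · have h1 : t - s ≤ 0 := by
      simp only [mem_Iic, not_le, mem_Iio] at hs ht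
      linarith
    simp [hq0 _ h1]

/-- The convolution of a Caputo kernel and a locally integrable function on `[0, ∞)` which is
continuous on `(0, ∞)`. -/
lemma caputoKernel_convolution {γ : ℝ} (hγ : γ ∈ Ioc (0 : ℝ) 1) {r : ℝ → ℝ} (hr : Measurable r)
    (hrc : ContinuousOn r (Ioi 0)) (hr0 : ∀ t ≤ 0, r t = 0) (hri : ∀ T, IntegrableOn r (Iic T)) :
    (∀ t, 0 < t → Integrable (fun s => r (t - s)) (caputoKernel γ)) ∧
      ContinuousOn (fun t => ∫ s, r (t - s) ∂caputoKernel γ) (Ioi 0) := by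
  by_cases h1 : γ = 1
  · simp only [caputoKernel, h1, if_true, integral_dirac, sub_zero]
    exact ⟨fun t _ => integrable_dirac (by simp), hrc⟩
  have hγ1 : 0 < 1 - γ := sub_pos.2 (lt_of_le_of_ne hγ.2 h1)
  have hG := Real.Gamma_pos_of_pos hγ1
  set k : ℝ → ℝ := (Ioi 0).indicator fun t => 1 / Real.Gamma (1 - γ) * t ^ (-γ) with hk
  have hkm : Measurable k := Measurable.indicator (by fun_prop) measurableSet_Ioi
  have hk0 : ∀ t, 0 ≤ k t := fun t => indicator_nonneg (fun t (ht : 0 < t) => by positivity) t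
  have hK : caputoKernel γ = volume.withDensity fun t => ENNReal.ofReal (k t) := by
    rw [caputoKernel, if_neg h1, ← withDensity_indicator measurableSet_Ioi]
    congr 1
    ext t
    by_cases ht : t ∈ Ioi (0 : ℝ) <;> simp [hk, ht]
  have hki : ∀ T, IntegrableOn k (Iic T) := by
    intro T
    rw [hk, IntegrableOn, integrable_indicator_iff measurableSet_Ioi, IntegrableOn,
      Measure.restrict_restrict measurableSet_Ioi]
    have : Ioi (0 : ℝ) ∩ Iic T = Ioc 0 T := rfl
    rw [this]
    rcases le_total T 0 with hT | hT
    · simp [Ioc_eq_empty_of_le hT]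
    · refine Integrable.const_mul ?_ _
      exact (intervalIntegrable_iff_integrableOn_Ioc_of_le hT).1
        (intervalIntegral.intervalIntegrable_rpow' (by linarith [hγ1]))
  have hkc : ContinuousOn k (Ioi 0) := by
    have : ContinuousOn (fun t : ℝ => 1 / Real.Gamma (1 - γ) * t ^ (-γ)) (Ioi 0) :=
      continuousOn_const.mul (continuousOn_id.rpow_const fun t (ht : 0 < t) => Or.inl ht.ne')
    exact this.congr fun t ht => by simp only [hk, indicator_of_mem ht]
  have hmain := continuousOn_convolution_halfLine hkm hr hkc hrc
    (fun t ht => by simp [hk, not_lt.2 ht]) hr0 hki hri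
  rw [hK]
  constructor
  · intro t ht
    rw [integrable_withDensity_iff_integrable_smul' (by fun_prop) (by simp)]
    simpa [ENNReal.toReal_ofReal, hk0] using hmain.1 t ht
  · refine hmain.2.congr fun t _ => ?_
    simp only
    rw [integral_withDensity_eq_integral_toReal_smul (by fun_prop) (by simp)]
    simp [ENNReal.toReal_ofReal, hk0]

/-- A measure below Lebesgue measure on `(0, ∞)` has a density bounded by `1`. -/
lemma exists_density_le_one {Q : Measure ℝ} (hQ : Q ≤ volume.restrict (Ioi 0)) :
    ∃ q : ℝ → ℝ, Measurable q ∧ (∀ t, 0 ≤ q t) ∧ (∀ t, q t ≤ 1) ∧ (∀ t ≤ 0, q t = 0) ∧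
      Q = volume.withDensity fun t => ENNReal.ofReal (q t) := by
  have : SigmaFinite Q := Measure.sigmaFinite_of_le _ hQ
  set d := Q.rnDeriv (volume.restrict (Ioi 0))
  have hd : d ≤ᵐ[volume.restrict (Ioi 0)] 1 := Measure.rnDeriv_le_one_of_le hQ
  have hdm : Measurable d := Measure.measurable_rnDeriv _ _
  refine ⟨(Ioi 0).indicator fun t => (min (d t) 1).toReal, ?_, ?_, ?_, ?_, ?_⟩
  · exact Measurable.indicator (by fun_prop) measurableSet_Ioi
  · exact fun t => indicator_nonneg (fun _ _ => ENNReal.toReal_nonneg) t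
  · refine fun t => indicator_apply_le' (fun _ => ?_) (fun _ => zero_le_one)
    exact ENNReal.toReal_le_of_le_ofReal zero_le_one (by simp)
  · intro t ht
    simp [not_lt.2 ht]
  · rw [← Measure.withDensity_rnDeriv_eq Q _ (Measure.absolutelyContinuous_of_le hQ)]
    have : (fun t => ENNReal.ofReal ((Ioi (0 : ℝ)).indicator (fun t => (min (d t) 1).toReal) t))
        = (Ioi (0 : ℝ)).indicator fun t => min (d t) 1 := by
      ext t
      by_cases ht : t ∈ Ioi (0 : ℝ)
      · simp only [indicator_of_mem ht]
        exact ENNReal.ofReal_toReal (by simp)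
      · simp [indicator_of_notMem ht]
    rw [this, withDensity_indicator measurableSet_Ioi]
    refine withDensity_congr_ae ?_
    filter_upwards [hd] with t ht
    exact (min_eq_left ht).symm

/-- A density `r` of the `κ`-potential `U` and the identities needed of it. -/
structure IsPotentialDensity (α ν a κ : ℝ) (U : Measure ℝ) (r : ℝ → ℝ) : Prop where
  measurable : Measurable r
  nonneg : ∀ t, 0 ≤ r t
  eq_zero : ∀ t ≤ 0, r t = 0
  continuousOn : ContinuousOn r (Ioi 0)
  withDensity_eq : U = volume.withDensity fun t => ENNReal.ofReal (r t)
  integrableOn : ∀ T, IntegrableOn r (Iic T)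
  bound : ∀ t, 0 < t → κ * r t ≤ 1 / t
  integrable_left : ∀ t, 0 < t → Integrable (fun s => r (t - s)) (caputoKernel α)
  integrable_right : ∀ t, 0 < t → Integrable (fun s => r (t - s)) (caputoKernel ν)
  resolvent : ∀ t, 0 < t → ∫ s, r (t - s) ∂caputoKernel α + a * ∫ s, r (t - s) ∂caputoKernel ν
    + κ * U.real (Iio t) = 1

lemma integrableOn_of_withDensity {U : Measure ℝ} {r : ℝ → ℝ} (hr : Measurable r)
    (hr0 : ∀ t, 0 ≤ r t) (hU : U = volume.withDensity fun t => ENNReal.ofReal (r t))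
    {T : ℝ} (hT : U (Iic T) < ∞) : IntegrableOn r (Iic T) := by
  refine ⟨hr.aestronglyMeasurable, ?_⟩
  rw [hasFiniteIntegral_iff_ofReal (ae_of_all _ hr0), ← withDensity_apply _ measurableSet_Iic,
    ← hU]
  exact hT

lemma setLIntegral_conv_of_withDensity {U : Measure ℝ} {r q : ℝ → ℝ} (hr : Measurable r)
    (hr0 : ∀ t, 0 ≤ r t) (hU : U = volume.withDensity fun t => ENNReal.ofReal (r t))
    (hq : Measurable q) (hq0 : ∀ t, 0 ≤ q t) (t : ℝ) :
    (∫⁻ s, ENNReal.ofReal (q (t - s)) ∂U).toReal = ∫ s, r s * q (t - s) := by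
  rw [hU, lintegral_withDensity_eq_lintegral_mul _ (by fun_prop) (by fun_prop),
    integral_eq_lintegral_of_nonneg_ae (ae_of_all _ fun s => mul_nonneg (hr0 _) (hq0 _))
    (Measurable.aestronglyMeasurable (by fun_prop))]
  simp [ENNReal.ofReal_mul, hr0]

namespace IsPotential

variable {α ν a κ : ℝ} {U : Measure ℝ}

/-- The potential has a density on `(0, ∞)`, continuous there. -/
lemma exists_continuous_density (hU : IsPotential α ν a κ U) (hα : α ∈ Ioc (0 : ℝ) 1)
    (hν : ν ∈ Ioc (0 : ℝ) 1) (ha : 0 < a) (hκ : 0 ≤ κ) :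
    ∃ r : ℝ → ℝ, Measurable r ∧ (∀ t, 0 ≤ r t) ∧ (∀ t ≤ 0, r t = 0) ∧
      ContinuousOn r (Ioi 0) ∧ U = volume.withDensity (fun t => ENNReal.ofReal (r t)) ∧
      ∀ t, 0 < t → t * r t ≤ U.real (Iio t) := by
  have := hU.sFinite
  set Kw := ENNReal.ofReal α • caputoKernel α + ENNReal.ofReal (a * ν) • caputoKernel ν with hKw
  -- Since α, ν ≤ 1, the weighted kernel lies below the memory kernel, and the resolvent identity
  -- bounds the convolution of the latter with U by Lebesgue measure.
  have hle : Kw ∗ U ≤ volume.restrict (Ioi 0) := by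
    rw [← hU.memoryKernel_conv hα.2 hν.2 ha hκ]
    refine (conv_mono_left ?_).trans (Measure.le_add_right le_rfl)
    refine Measure.le_iff.2 fun s _ => ?_
    simp only [hKw, memoryKernel, Measure.add_apply, Measure.smul_apply, smul_eq_mul]
    refine add_le_add (mul_le_of_le_one_left zero_le ?_)
      (mul_le_mul_left (ENNReal.ofReal_le_ofReal ?_) _)
    · simpa using hα.2
    · exact mul_le_of_le_one_right ha.le hν.2
  obtain ⟨q, hqm, hq0, hq1, hqz, hQ⟩ := exists_density_le_one hle
  -- This is the density q ∗ U of t U(dt). From q ≤ 1 and q = 0 on (-∞, 0] it is at most U(-∞, t),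
  -- which gives the bound on t r(t).
  set g : ℝ → ℝ≥0∞ := fun t => ∫⁻ s, ENNReal.ofReal (q (t - s)) ∂U with hg
  have hgm : Measurable g := Measurable.lintegral_prod_right (by fun_prop)
  have hgU : ∀ t, g t ≤ U (Iio t) := by
    intro t
    rw [← lintegral_indicator_one measurableSet_Iio]
    refine lintegral_mono fun s => ?_
    by_cases hs : s ∈ Iio t
    · simpa [hs] using hq1 _
    · have : t - s ≤ 0 := by simpa using hs
      simp [hs, hqz _ this]
  have hgfin : ∀ t, g t ≠ ∞ := fun t =>
    ((hgU t).trans (measure_mono Iio_subset_Iic_self)).trans_lt (hU.measure_Iic_lt_top t) |>.ne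
  have hgz : ∀ t ≤ 0, g t = 0 := fun t ht =>
    le_antisymm ((hgU t).trans ((measure_mono (Iio_subset_Iio ht)).trans hU.measure_Iio.le))
      zero_le
  have hid : U.withDensity (fun t => ENNReal.ofReal t) = volume.withDensity g := by
    rw [hU.withDensity_id hα hν ha hκ, ← hKw, hQ, withDensity_conv (by fun_prop)]
  set r : ℝ → ℝ := fun t => (g t).toReal / t with hr
  have hrm : Measurable r := by fun_prop
  have hrz : ∀ t ≤ 0, r t = 0 := fun t ht => by simp [hr, hgz t ht]
  have hr0 : ∀ t, 0 ≤ r t := by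
    intro t
    rcases le_or_gt t 0 with ht | ht
    · rw [hrz t ht]
    · exact div_nonneg ENNReal.toReal_nonneg ht.le
  have hUr : U = volume.withDensity fun t => ENNReal.ofReal (r t) := by
    have hne : ∀ᵐ t ∂U, ENNReal.ofReal t ≠ 0 := by
      have h0 : ∀ᵐ t ∂U, t ≠ 0 := by
        rw [ae_iff]
        simpa using hU.measure_singleton_zero hα.1 ha hκ
      filter_upwards [ae_nonneg_of_Iio hU.measure_Iio, h0] with t ht ht0
      simpa using lt_of_le_of_ne ht ht0.symm
    rw [← withDensity_inv_same (μ := U) (f := fun t => ENNReal.ofReal t) (by fun_prop) hne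
      (by simp), hid, ← withDensity_mul _ hgm (by fun_prop)]
    congr 1
    ext t
    rcases le_or_gt t 0 with ht | ht
    · simp [hgz t ht, hrz t ht]
    · rw [hr, ENNReal.ofReal_div_of_pos ht, ENNReal.ofReal_toReal (hgfin t)]
      rfl
  have hri : ∀ T, IntegrableOn r (Iic T) := fun T =>
    integrableOn_of_withDensity hrm hr0 hUr (hU.measure_Iic_lt_top T)
  refine ⟨r, hrm, hr0, hrz, ?_, hUr, fun t ht => ?_⟩
  · have hc : Continuous fun t => ∫ s, r s * q (t - s) :=
      continuous_convolution_of_bounded_halfLine hri hqm hqz (M := 1) fun x => by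
        rw [abs_of_nonneg (hq0 x)]; exact hq1 x
    have : ContinuousOn (fun t => (∫ s, r s * q (t - s)) / t) (Ioi 0) :=
      hc.continuousOn.div continuousOn_id fun t (ht : 0 < t) => ht.ne'
    refine this.congr fun t _ => ?_
    simp only [hr, hg]
    rw [setLIntegral_conv_of_withDensity hrm hr0 hUr hqm hq0]
  · rw [hr, mul_div_cancel₀ _ ht.ne']
    exact ENNReal.toReal_mono
      ((measure_mono Iio_subset_Iic_self).trans_lt (hU.measure_Iic_lt_top t)).ne (hgU t)

/-- Comparing densities in the resolvent identity gives an equality almost everywhere; both sides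
are continuous on (0, ∞), so it holds at every t > 0. All terms in it are nonnegative, hence κ U(-∞,
t) ≤ 1, and the bound on r follows from t r(t) ≤ U(-∞, t). -/
theorem exists_isPotentialDensity (hU : IsPotential α ν a κ U) (hα : α ∈ Ioc (0 : ℝ) 1)
    (hν : ν ∈ Ioc (0 : ℝ) 1) (ha : 0 < a) (hκ : 0 ≤ κ) :
    ∃ r, IsPotentialDensity α ν a κ U r := by
  have := hU.sFinite
  obtain ⟨r, hrm, hr0, hrz, hrc, hUr, hrU⟩ := hU.exists_continuous_density hα hν ha hκ
  have hri : ∀ T, IntegrableOn r (Iic T) := fun T =>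
    integrableOn_of_withDensity hrm hr0 hUr (hU.measure_Iic_lt_top T)
  have hA := caputoKernel_convolution hα hrm hrc hrz hri
  have hB := caputoKernel_convolution hν hrm hrc hrz hri
  set F : ℝ → ℝ := fun t => ∫ s, r (t - s) ∂caputoKernel α + a * ∫ s, r (t - s) ∂caputoKernel ν
    + κ * U.real (Iio t) with hF
  set one : ℝ → ℝ := (Ioi 0).indicator 1 with hone
  have honem : Measurable one := measurable_one.indicator measurableSet_Ioi
  have hone0 : ∀ t, 0 ≤ one t := fun t => indicator_nonneg (fun _ _ => zero_le_one) t
  have hUone : ∀ t, ∫⁻ s, ENNReal.ofReal (one (t - s)) ∂U = U (Iio t) := by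
    intro t
    rw [← lintegral_indicator_one measurableSet_Iio]
    refine lintegral_congr fun s => ?_
    by_cases hs : s < t <;> simp [hone, hs, indicator]
  have hUc : Continuous fun t => U.real (Iio t) := by
    have := continuous_convolution_of_bounded_halfLine hri honem
      (fun t ht => by simp [hone, not_lt.2 ht]) (M := 1) fun x => by
        rw [abs_of_nonneg (hone0 x)]
        exact indicator_apply_le' (fun _ => le_rfl) fun _ => zero_le_one
    convert this using 2 with t
    rw [← setLIntegral_conv_of_withDensity hrm hr0 hUr honem hone0, hUone, Measure.real]
  have hUfin : ∀ t, U (Iio t) ≠ ∞ := fun t =>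
    ((measure_mono Iio_subset_Iic_self).trans_lt (hU.measure_Iic_lt_top t)).ne
  have hae : ∀ᵐ t, t ∈ Ioi (0 : ℝ) → F t = 1 := by
    have h := hU.memoryKernel_conv hα.2 hν.2 ha hκ
    have hvol : volume.restrict (Ioi (0 : ℝ))
        = volume.withDensity fun t => ENNReal.ofReal (one t) := by
      rw [← withDensity_one (μ := volume.restrict (Ioi (0 : ℝ))),
        ← withDensity_indicator measurableSet_Ioi]
      congr 1
      ext t
      by_cases ht : t ∈ Ioi (0 : ℝ) <;> simp [hone, ht]
    have h1 : memoryKernel α ν a ∗ U = volume.withDensity fun t =>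
        ∫⁻ s, ENNReal.ofReal (r (t - s)) ∂memoryKernel α ν a := by
      rw [Measure.conv_comm]
      conv_lhs => rw [hUr]
      rw [withDensity_conv (by fun_prop)]
    have hUm : Measurable fun t => U (Iio t) := by
      simp_rw [← hUone]
      exact Measurable.lintegral_prod_right (by fun_prop)
    have hm1 : Measurable fun t => ∫⁻ s, ENNReal.ofReal (r (t - s)) ∂memoryKernel α ν a :=
      Measurable.lintegral_prod_right (by fun_prop)
    have h2 : volume.restrict (Ioi (0 : ℝ)) ∗ U = volume.withDensity fun t => U (Iio t) := by
      rw [hvol, withDensity_conv (by fun_prop)]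
      simp_rw [hUone]
    rw [h1, h2, hvol, ← withDensity_smul _ hUm, ← withDensity_add_left hm1,
      withDensity_eq_iff_of_sigmaFinite (hm1.add (hUm.const_smul _)).aemeasurable
        (by fun_prop)] at h
    filter_upwards [h] with t ht ht0
    have ht0' : 0 < t := ht0
    simp only [Pi.add_apply, Pi.smul_apply, smul_eq_mul, memoryKernel, lintegral_add_measure,
      lintegral_smul_measure] at ht
    have hnn : ∀ γ, 0 ≤ ∫ s, r (t - s) ∂caputoKernel γ := fun γ =>
      integral_nonneg fun s => hr0 _
    rw [← ofReal_integral_eq_lintegral_ofReal (hA.1 t ht0) (ae_of_all _ fun s => hr0 _),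
      ← ofReal_integral_eq_lintegral_ofReal (hB.1 t ht0) (ae_of_all _ fun s => hr0 _),
      ← ENNReal.ofReal_mul ha.le, ← ENNReal.ofReal_add (hnn α) (mul_nonneg ha.le (hnn ν)),
      ← ENNReal.ofReal_toReal (hUfin t), ← ENNReal.ofReal_mul hκ,
      ← ENNReal.ofReal_add (add_nonneg (hnn α) (mul_nonneg ha.le (hnn ν))) (by positivity)] at ht
    have h3 := (ENNReal.ofReal_eq_ofReal_iff (add_nonneg (add_nonneg (hnn α)
      (mul_nonneg ha.le (hnn ν))) (by positivity)) (hone0 t)).1 ht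
    simpa [hone, ht0', hF, Measure.real] using h3
  have hFc : ContinuousOn F (Ioi 0) :=
    (hA.2.add (continuousOn_const.mul hB.2)).add (continuousOn_const.mul hUc.continuousOn)
  have hF1 : EqOn F (fun _ => 1) (Ioi 0) :=
    Measure.eqOn_open_of_ae_eq (μ := volume) ((ae_restrict_iff' measurableSet_Ioi).2 hae)
      isOpen_Ioi hFc continuousOn_const
  refine ⟨r, hrm, hr0, hrz, hrc, hUr, hri, fun t ht => ?_, hA.1, hB.1, fun t ht => hF1 ht⟩
  have h1 : F t = 1 := hF1 ht
  have h2 : 0 ≤ ∫ s, r (t - s) ∂caputoKernel α := integral_nonneg fun s => hr0 _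
  have h3 : 0 ≤ a * ∫ s, r (t - s) ∂caputoKernel ν :=
    mul_nonneg ha.le (integral_nonneg fun s => hr0 _)
  rw [le_div_iff₀ ht]
  calc κ * r t * t = κ * (t * r t) := by ring
    _ ≤ κ * U.real (Iio t) := mul_le_mul_of_nonneg_left (hrU t ht) hκ
    _ ≤ 1 := by rw [← h1, hF]; linarith

end IsPotential

/-! ### Subordinators, their potential measures and first passage times. -/

section Paths

variable {Ω : Type*} [MeasurableSpace Ω] {P : Measure Ω}

/-- A nonnegative process, a.s. nondecreasing, with `E exp (-x H(s)) = exp (-s ψ(x))`. -/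
structure HasLaplaceExponent (ψ : ℝ → ℝ) (H : ℝ≥0 → Ω → ℝ) (P : Measure Ω) : Prop where
  measurable : ∀ s, Measurable (H s)
  nonneg : ∀ᵐ ω ∂P, ∀ s, 0 ≤ H s ω
  monotone : ∀ᵐ ω ∂P, Monotone fun s => H s ω
  laplace : ∀ (s : ℝ≥0) (x : ℝ), 0 < x →
    ∫⁻ ω, ENNReal.ofReal (Real.exp (-(x * H s ω))) ∂P = ENNReal.ofReal (Real.exp (-(s * ψ x)))

lemma IsStableSubordinator.hasLaplaceExponent {γ : ℝ} {H : ℝ≥0 → Ω → ℝ}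
    (h : IsStableSubordinator γ H P) : HasLaplaceExponent (fun x => x ^ γ) H P where
  measurable := h.levy.measurable
  nonneg := by
    filter_upwards [h.levy.zero, h.monotone] with ω h0 hm s
    rw [← h0]
    exact hm zero_le
  monotone := h.monotone
  laplace s x hx := by
    rw [← h.laplace s x hx, ofReal_integral_eq_lintegral_ofReal _
      (ae_of_all _ fun _ => by positivity)]
    by_contra hc
    have := h.laplace s x hx
    rw [integral_undef hc] at this
    exact (Real.exp_pos _).ne this

/-- Independence multiplies the two Laplace transforms, and ((2λ)^(1/ν) x)^ν = 2λ x^ν. -/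
lemma hasLaplaceExponent_combinedSubordinator {α ν lam : ℝ} (hν : 0 < ν) (hlam : 0 < lam)
    {H₁ H₂ : ℝ≥0 → Ω → ℝ} (hH₁ : IsStableSubordinator α H₁ P) (hH₂ : IsStableSubordinator ν H₂ P)
    (hind : IndepFun (fun ω t => H₁ t ω) (fun ω t => H₂ t ω) P) :
    HasLaplaceExponent (symbol α ν (2 * lam)) (combinedSubordinator lam ν H₁ H₂) P := by
  have h1 := hH₁.hasLaplaceExponent
  have h2 := hH₂.hasLaplaceExponent
  have hb : 0 < (2 * lam) ^ (1 / ν) := by positivity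
  have hm1 := h1.measurable
  have hm2 := h2.measurable
  refine ⟨fun s => ?_, ?_, ?_, fun s x hx => ?_⟩
  · unfold combinedSubordinator; fun_prop
  · filter_upwards [h1.nonneg, h2.nonneg] with ω k1 k2 s
    exact add_nonneg (k1 s) (mul_nonneg hb.le (k2 s))
  · filter_upwards [h1.monotone, h2.monotone] with ω k1 k2
    exact k1.add (k2.const_mul hb.le)
  · have hi : IndepFun (fun ω => ENNReal.ofReal (Real.exp (-(x * H₁ s ω))))
        (fun ω => ENNReal.ofReal (Real.exp (-(x * (2 * lam) ^ (1 / ν) * H₂ s ω)))) P :=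
      hind.comp (φ := fun f : ℝ≥0 → ℝ => ENNReal.ofReal (Real.exp (-(x * f s))))
        (ψ := fun f : ℝ≥0 → ℝ => ENNReal.ofReal (Real.exp (-(x * (2 * lam) ^ (1 / ν) * f s))))
        (by fun_prop) (by fun_prop)
    have := lintegral_mul_eq_lintegral_mul_lintegral_of_indepFun'' (by fun_prop) (by fun_prop) hi
    rw [h1.laplace s x hx, h2.laplace s _ (by positivity : 0 < x * (2 * lam) ^ (1 / ν))] at this
    rw [← ENNReal.ofReal_mul (Real.exp_nonneg _), ← Real.exp_add] at this
    refine Eq.trans (lintegral_congr fun ω => ?_) (this.trans ?_)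
    · rw [← ENNReal.ofReal_mul (Real.exp_nonneg _), ← Real.exp_add, combinedSubordinator]
      congr 2
      ring
    · congr 2
      rw [Real.mul_rpow hx.le hb.le, ← Real.rpow_mul (by positivity), one_div,
        inv_mul_cancel₀ hν.ne', Real.rpow_one, symbol]
      ring

/-- The `κ`-potential measure `∫₀^∞ exp (-κ s) P(H(s) ∈ ·) ds`. -/
noncomputable def potentialMeasure (κ : ℝ) (H : ℝ≥0 → Ω → ℝ) (P : Measure Ω) : Measure ℝ :=
  ((volume.restrict (Ioi 0)).withDensity fun s => ENNReal.ofReal (Real.exp (-(κ * s)))).bind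
    fun s => P.map (H s.toNNReal)

namespace HasLaplaceExponent

variable {ψ : ℝ → ℝ} {H : ℝ≥0 → Ω → ℝ}

/-- Half-lines (-∞, t] form a generating π-system, and s ↦ P(H(s) ≤ t) is antitone because paths are
nondecreasing. -/
lemma measurable_map [IsProbabilityMeasure P] (hH : HasLaplaceExponent ψ H P) :
    Measurable fun s : ℝ => P.map (H s.toNNReal) := by
  have : ∀ s : ℝ, IsProbabilityMeasure (P.map (H s.toNNReal)) := fun s =>
    Measure.isProbabilityMeasure_map (hH.measurable _).aemeasurable
  refine Measurable.measure_of_isPiSystem_of_isProbabilityMeasure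
    (borel_eq_generateFrom_Iic ℝ ▸ BorelSpace.measurable_eq) isPiSystem_Iic ?_
  rintro _ ⟨t, rfl⟩
  refine Antitone.measurable fun s s' hss => ?_
  simp only [Measure.map_apply (hH.measurable _) measurableSet_Iic]
  refine measure_mono_ae ?_
  filter_upwards [hH.monotone] with ω hω h
  exact (hω (Real.toNNReal_le_toNNReal hss)).trans h

/-- By Tonelli the transform is the integral of exp(-κ s) exp(-s ψ(x)) over s > 0. -/
lemma isPotential [IsProbabilityMeasure P] {α ν a κ : ℝ}
    (hH : HasLaplaceExponent (symbol α ν a) H P) (ha : 0 < a) (hκ : 0 ≤ κ) :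
    IsPotential α ν a κ (potentialMeasure κ H P) := by
  constructor
  · rw [potentialMeasure, Measure.bind_apply measurableSet_Iio hH.measurable_map.aemeasurable]
    refine (lintegral_congr fun s => ?_).trans lintegral_zero
    rw [Measure.map_apply (hH.measurable _) measurableSet_Iio]
    refine measure_mono_null (t := {ω | ¬ ∀ s, 0 ≤ H s ω}) (fun ω hω h => ?_) hH.nonneg
    exact not_lt.2 (h _) hω
  · intro x hx
    have hs := symbol_pos (α := α) (ν := ν) ha hx
    rw [FracCauchy.laplace, potentialMeasure, Measure.lintegral_bind hH.measurable_map.aemeasurable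
      (by fun_prop)]
    have h1 : ∀ s : ℝ, ∫⁻ t, ENNReal.ofReal (Real.exp (-(x * t))) ∂P.map (H s.toNNReal)
        = ENNReal.ofReal (Real.exp (-(s.toNNReal * symbol α ν a x))) := fun s => by
      rw [lintegral_map (by fun_prop) (hH.measurable _), hH.laplace _ x hx]
    simp_rw [h1]
    rw [lintegral_withDensity_eq_lintegral_mul _ (by fun_prop) (by fun_prop)]
    rw [← laplace_halfLine (by positivity : 0 < κ + symbol α ν a x), FracCauchy.laplace]
    refine setLIntegral_congr_fun measurableSet_Ioi fun s hs => ?_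
    rw [Pi.mul_apply, ← ENNReal.ofReal_mul (Real.exp_nonneg _), ← Real.exp_add,
      Real.coe_toNNReal s (le_of_lt hs)]
    congr 2
    ring

/-- Chernoff's bound: for each n, the probability that H stays below N at all positive integers is
at most exp(N) exp(-(n + 1) ψ(1)), which tends to 0. This makes the set defining the first passage
time nonempty, so that its infimum is not the default value 0. -/
lemma ae_unbounded [IsProbabilityMeasure P] (hH : HasLaplaceExponent ψ H P) (hψ : 0 < ψ 1) :
    ∀ᵐ ω ∂P, ∀ t, ∃ q : ℚ≥0, 0 < q ∧ t < H q ω := by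
  have hm := hH.measurable
  have key : ∀ N : ℕ, ∀ᵐ ω ∂P, ∃ n : ℕ, (N : ℝ) < H (n + 1 : ℕ) ω := by
    intro N
    rw [ae_iff]
    simp only [not_exists, not_lt]
    have hle : ∀ n : ℕ, P {ω | ∀ n : ℕ, H (n + 1 : ℕ) ω ≤ N}
        ≤ ENNReal.ofReal (Real.exp N * Real.exp (-(ψ 1)) ^ (n + 1)) := by
      intro n
      have h1 := hH.laplace (n + 1 : ℕ) 1 one_pos
      have h2 : ENNReal.ofReal (Real.exp (-N)) * P {ω | ∀ n : ℕ, H (n + 1 : ℕ) ω ≤ N}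
          ≤ ENNReal.ofReal (Real.exp (-(((n + 1 : ℕ) : ℝ≥0) * ψ 1))) := by
        rw [← h1]
        refine le_trans ?_ (mul_meas_ge_le_lintegral₀ (by fun_prop)
          (ENNReal.ofReal (Real.exp (-(N : ℝ)))))
        refine mul_le_mul_right (measure_mono fun ω (hω : ∀ n : ℕ, H (n + 1 : ℕ) ω ≤ N) => ?_) _
        exact ENNReal.ofReal_le_ofReal (Real.exp_le_exp.2 (by simpa using hω n))
      have h3 : ENNReal.ofReal (Real.exp N) * ENNReal.ofReal (Real.exp (-N)) = 1 := by
        rw [← ENNReal.ofReal_mul (Real.exp_nonneg _), ← Real.exp_add]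
        simp
      calc P {ω | ∀ n : ℕ, H (n + 1 : ℕ) ω ≤ N}
          = ENNReal.ofReal (Real.exp N) * (ENNReal.ofReal (Real.exp (-N))
            * P {ω | ∀ n : ℕ, H (n + 1 : ℕ) ω ≤ N}) := by rw [← mul_assoc, h3, one_mul]
        _ ≤ _ := by
          refine (mul_le_mul_right h2 _).trans_eq ?_
          rw [← ENNReal.ofReal_mul (Real.exp_nonneg _), ← Real.exp_nat_mul]
          push_cast
          ring_nf
    have hlim : Tendsto (fun n : ℕ => ENNReal.ofReal (Real.exp N * Real.exp (-(ψ 1)) ^ (n + 1)))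
        atTop (𝓝 0) := by
      have h := ((tendsto_pow_atTop_nhds_zero_of_lt_one (Real.exp_nonneg (-(ψ 1)))
        (Real.exp_lt_one_iff.2 (by linarith))).comp (tendsto_add_atTop_nat 1)).const_mul (Real.exp N)
      rw [mul_zero] at h
      simpa [Function.comp_def] using (ENNReal.continuous_ofReal.tendsto 0).comp h
    exact le_antisymm (ge_of_tendsto' hlim hle) zero_le
  filter_upwards [ae_all_iff.2 key] with ω hω t
  obtain ⟨N, hN⟩ := exists_nat_ge t
  obtain ⟨n, hn⟩ := hω N
  refine ⟨(n + 1 : ℕ), by positivity, ?_⟩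
  simpa using hN.trans_lt hn

end HasLaplaceExponent

/-- The first passage time of a path, computed along rational times. -/
noncomputable def ratPassage (t : ℝ) (h : ℝ≥0 → ℝ) : ℝ≥0 :=
  (⨅ q : ℚ≥0, {h : ℝ≥0 → ℝ | 0 < q ∧ t < h q}.piecewise
    (fun _ => ((q : ℝ≥0) : ℝ≥0∞)) (fun _ => ∞) h).toNNReal

lemma measurable_ratPassage (t : ℝ) : Measurable (ratPassage t) := by
  refine (Measurable.iInf fun q => ?_).ennreal_toNNReal
  refine Measurable.piecewise ?_ measurable_const measurable_const
  refine MeasurableSet.inter (MeasurableSet.const _) ?_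
  exact measurableSet_lt measurable_const (measurable_pi_apply _)

/-- An infimum over uncountably many times is replaced by a countable one, a measurable function of
the whole path. Measurability of L and its independence from S follow from this form. -/
lemma inverseProcess_eq_ratPassage {Ω : Type*} {H : ℝ≥0 → Ω → ℝ} {ω : Ω} (hm : Monotone fun s => H s ω)
    (hu : ∀ t, ∃ q : ℚ≥0, 0 < q ∧ t < H q ω) (t : ℝ) :
    inverseProcess H t ω = ratPassage t fun s => H s ω := by
  set A : Set ℝ≥0 := {s | 0 < s ∧ t < H s ω} with hA
  set I : ℝ≥0∞ := ⨅ q : ℚ≥0, {h : ℝ≥0 → ℝ | 0 < q ∧ t < h q}.piecewise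
    (fun _ => ((q : ℝ≥0) : ℝ≥0∞)) (fun _ => ∞) fun s => H s ω with hI
  have hIle : ∀ q : ℚ≥0, 0 < q → t < H q ω → I ≤ ((q : ℝ≥0) : ℝ≥0∞) := by
    intro q hq hqt
    refine (iInf_le _ q).trans ?_
    rw [piecewise_eq_of_mem _ _ _ (show (fun s => H s ω) ∈ {h : ℝ≥0 → ℝ | 0 < q ∧ t < h q}
      from ⟨hq, hqt⟩)]
  have hne : A.Nonempty := by
    obtain ⟨q, hq, hqt⟩ := hu t
    exact ⟨q, by exact_mod_cast hq, hqt⟩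
  have hEq : ((sInf A : ℝ≥0) : ℝ≥0∞) = I := by
    refine le_antisymm (le_iInf fun q => ?_) (le_of_forall_gt fun c hc => ?_)
    · by_cases hq : 0 < q ∧ t < H q ω
      · rw [piecewise_eq_of_mem _ _ _ (show (fun s => H s ω) ∈ {h : ℝ≥0 → ℝ | 0 < q ∧ t < h q}
          from hq)]
        exact ENNReal.coe_le_coe.2 (csInf_le' ⟨by exact_mod_cast hq.1, hq.2⟩)
      · rw [piecewise_eq_of_notMem _ _ _ (show (fun s => H s ω) ∉ {h : ℝ≥0 → ℝ | 0 < q ∧ t < h q}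
          from hq)]
        exact le_top
    · obtain ⟨d, hd1, hd2⟩ := ENNReal.lt_iff_exists_nnreal_btwn.1 hc
      obtain ⟨s, hs, hsd⟩ := exists_lt_of_csInf_lt hne (ENNReal.coe_lt_coe.1 hd1)
      -- A passage time s may be moved to a slightly later rational, where H still exceeds t by
      -- monotonicity.
      obtain ⟨q', hq', hq1, hq2⟩ := (NNReal.lt_iff_exists_rat_btwn _ _).1 hsd
      lift q' to ℚ≥0 using hq' with q
      have hcast : Real.toNNReal ((q : ℚ) : ℝ) = (q : ℝ≥0) := by
        ext
        rw [Real.coe_toNNReal _ (by positivity)]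
        rfl
      rw [hcast] at hq1 hq2
      refine ((hIle q ?_ (hs.2.trans_le (hm hq1.le))).trans_lt
        (ENNReal.coe_lt_coe.2 hq2)).trans hd2
      exact_mod_cast hs.1.trans hq1
  rw [inverseProcess, ratPassage, ← hI, ← hEq, ENNReal.toNNReal_coe]

/-- Together with `le_inverseProcess` this sandwiches {H(s) ≤ t} between {L(t) > s} and {L(t) ≥ s}.
-/
lemma le_of_lt_inverseProcess {Ω : Type*} {H : ℝ≥0 → Ω → ℝ} {ω : Ω} {t : ℝ} {s : ℝ≥0} (hs : 0 < s)
    (h : s < inverseProcess H t ω) : H s ω ≤ t := by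
  by_contra hc
  exact not_le.2 h (csInf_le' ⟨hs, not_le.1 hc⟩)

lemma le_inverseProcess {Ω : Type*} {H : ℝ≥0 → Ω → ℝ} {ω : Ω} (hm : Monotone fun s => H s ω)
    (hu : ∀ t, ∃ q : ℚ≥0, 0 < q ∧ t < H q ω) {t : ℝ} {s : ℝ≥0} (h : H s ω ≤ t) :
    s ≤ inverseProcess H t ω := by
  refine le_csInf ?_ fun s' hs' => ?_
  · obtain ⟨q, hq, hqt⟩ := hu t
    exact ⟨q, by exact_mod_cast hq, hqt⟩
  · by_contra hc
    exact not_le.2 hs'.2 ((hm (not_le.1 hc).le).trans h)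

/-- The Laplace transform of the inverse process in terms of the potential. -/
lemma integral_exp_inverseProcess [IsProbabilityMeasure P] {ψ : ℝ → ℝ} {H : ℝ≥0 → Ω → ℝ}
    (hH : HasLaplaceExponent ψ H P) (hψ : 0 < ψ 1) {κ : ℝ} (hκ : 0 ≤ κ) (t : ℝ) :
    ∫ ω, Real.exp (-(κ * inverseProcess H t ω)) ∂P
      = 1 - κ * (potentialMeasure κ H P).real (Iic t) := by
  set T : Ω → ℝ := fun ω => inverseProcess H t ω with hT
  have hH' : Measurable fun ω s => H s ω := measurable_pi_iff.2 hH.measurable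
  have hTm : AEMeasurable T P := by
    refine ⟨fun ω => ratPassage t fun s => H s ω, ?_, ?_⟩
    · exact ((measurable_ratPassage t).comp hH').coe_nnreal_real
    · filter_upwards [hH.monotone, hH.ae_unbounded hψ] with ω hm hu
      simp only [hT, inverseProcess_eq_ratPassage hm hu]
  have hg : ∀ s, ∫ x in (0 : ℝ)..s, κ * Real.exp (-(κ * x)) = 1 - Real.exp (-(κ * s)) := by
    intro s
    have : ∀ x ∈ uIcc 0 s, HasDerivAt (fun x => -Real.exp (-(κ * x)))
        (κ * Real.exp (-(κ * x))) x := by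
      intro x _
      have := ((hasDerivAt_id x).const_mul κ).neg.exp.neg
      refine this.congr_deriv ?_
      simp [mul_comm]
    rw [intervalIntegral.integral_eq_sub_of_hasDerivAt this
      (Continuous.intervalIntegrable (by fun_prop) _ _)]
    simp
    ring
  -- Layer-cake formula for 1 - exp(-κ L), the primitive of κ exp(-κ x).
  have hlayer := lintegral_comp_eq_lintegral_meas_lt_mul P (f := T)
    (g := fun x => κ * Real.exp (-(κ * x))) (ae_of_all _ fun ω => NNReal.coe_nonneg _) hTm
    (fun s _ => Continuous.intervalIntegrable (by fun_prop) _ _) (ae_of_all _ fun x => by positivity)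
  simp_rw [hg] at hlayer
  -- The events {L > s} and {L ≥ s} have equal probability for almost every s, and {H(s) ≤ t} is
  -- caught between them.
  have hmeas : ∀ᵐ s ∂volume.restrict (Ioi (0 : ℝ)),
      P {ω | s < T ω} = P.map (H s.toNNReal) (Iic t) := by
    filter_upwards [meas_le_ae_eq_meas_lt P (volume.restrict (Ioi (0 : ℝ))) T,
      ae_restrict_mem measurableSet_Ioi] with s hs hs0
    have hs0' : 0 < s.toNNReal := Real.toNNReal_pos.2 hs0
    rw [Measure.map_apply (hH.measurable _) measurableSet_Iic]
    refine le_antisymm (measure_mono fun ω hω => ?_) (hs ▸ measure_mono_ae ?_)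
    · exact le_of_lt_inverseProcess hs0' ((Real.toNNReal_lt_iff_lt_coe (le_of_lt hs0)).2 hω)
    · filter_upwards [hH.monotone, hH.ae_unbounded hψ] with ω hm hu hω
      exact Real.toNNReal_le_iff_le_coe.1 (le_inverseProcess hm hu hω)
  have hPm : Measurable fun s : ℝ => P.map (H s.toNNReal) (Iic t) :=
    (Measure.measurable_coe measurableSet_Iic).comp hH.measurable_map
  have hpot : ∫⁻ ω, ENNReal.ofReal (1 - Real.exp (-(κ * T ω))) ∂P
      = ENNReal.ofReal κ * potentialMeasure κ H P (Iic t) := by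
    rw [hlayer, potentialMeasure, Measure.bind_apply measurableSet_Iic
      hH.measurable_map.aemeasurable, lintegral_withDensity_eq_lintegral_mul _ (by fun_prop) hPm,
      ← lintegral_const_mul _ (Measurable.mul (by fun_prop) hPm)]
    refine lintegral_congr_ae ?_
    filter_upwards [hmeas] with s hs
    rw [hs, ENNReal.ofReal_mul hκ, Pi.mul_apply]
    ring
  have h01 : ∀ ω, Real.exp (-(κ * T ω)) ≤ 1 := fun ω =>
    Real.exp_le_one_iff.2 (neg_nonpos.2 (mul_nonneg hκ (NNReal.coe_nonneg _)))
  have hint : Integrable (fun ω => Real.exp (-(κ * T ω))) P :=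
    Integrable.of_bound (AEMeasurable.aestronglyMeasurable (by fun_prop)) 1 (ae_of_all _ fun ω => by
        rw [Real.norm_eq_abs, abs_of_pos (Real.exp_pos _)]; exact h01 ω)
  have hreal : ∫ ω, (1 - Real.exp (-(κ * T ω))) ∂P
      = κ * (potentialMeasure κ H P).real (Iic t) := by
    rw [integral_eq_lintegral_of_nonneg_ae (ae_of_all _ fun ω => sub_nonneg.2 (h01 ω))
      ((integrable_const 1).sub hint).aestronglyMeasurable, hpot, ENNReal.toReal_mul,
      ENNReal.toReal_ofReal hκ, Measure.real]
  rw [integral_sub (integrable_const 1) hint] at hreal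
  simp only [integral_const, probReal_univ, smul_eq_mul, mul_one] at hreal
  linarith

end Paths

/-! ### Subordination of the stable process. -/

section Subordination

variable {Ω : Type*} [MeasurableSpace Ω] {P : Measure Ω}

/-- The dyadic approximation from the right of a time. -/
noncomputable def dyadicAbove (k : ℕ) (j : ℕ) : ℝ≥0 := (j + 1) / 2 ^ k

lemma dyadicAbove_floor_gt (k : ℕ) (x : ℝ≥0) : x < dyadicAbove k ⌊2 ^ k * x⌋₊ := by
  rw [dyadicAbove, lt_div_iff₀ (by positivity), mul_comm]
  exact Nat.lt_floor_add_one _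

/-- The approach is from the right because the paths of S are only right-continuous. -/
lemma tendsto_dyadicAbove_floor (x : ℝ≥0) :
    Tendsto (fun k => dyadicAbove k ⌊2 ^ k * x⌋₊) atTop (𝓝[≥] x) := by
  refine tendsto_nhdsWithin_iff.2 ⟨?_, Eventually.of_forall fun k => (dyadicAbove_floor_gt k x).le⟩
  have hle : ∀ k, dyadicAbove k ⌊2 ^ k * x⌋₊ ≤ x + (1 / 2) ^ k := by
    intro k
    rw [dyadicAbove, div_le_iff₀ (by positivity), add_mul, one_div, inv_pow,
      inv_mul_cancel₀ (by positivity), mul_comm x]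
    gcongr
    exact Nat.floor_le zero_le
  have h2 : Tendsto (fun k : ℕ => x + (1 / 2 : ℝ≥0) ^ k) atTop (𝓝 x) := by
    have h3 : (1 / 2 : ℝ≥0) < 1 := by
      rw [← NNReal.coe_lt_coe]; norm_num
    simpa using (NNReal.tendsto_pow_atTop_nhds_zero_of_lt_one h3).const_add x
  exact tendsto_of_tendsto_of_tendsto_of_le_of_le tendsto_const_nhds h2
    (fun k => (dyadicAbove_floor_gt k x).le) hle

variable {n : ℕ} {β : ℝ} {S : ℝ≥0 → Ω → EuclideanSpace ℝ (Fin n)} {T : Ω → ℝ≥0}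

/-- The random time takes countably many values, so measurability of S at each fixed time is enough;
no joint measurability in time is needed. -/
lemma measurable_comp_dyadicAbove (hS : ∀ s, Measurable (S s)) (hT : Measurable T) (k : ℕ) :
    Measurable fun ω => S (dyadicAbove k ⌊2 ^ k * T ω⌋₊) ω := by
  have h1 : Measurable fun p : Ω × ℕ => S (dyadicAbove k p.2) p.1 := by
    refine measurable_from_prod_countable_left fun j => ?_
    simp only
    exact hS (dyadicAbove k j)
  have h2 : Measurable fun ω => ⌊2 ^ k * T ω⌋₊ := Nat.measurable_floor.comp (by fun_prop)
  exact Measurable.comp (f := fun ω => (ω, ⌊2 ^ k * T ω⌋₊)) h1 (measurable_id.prodMk h2)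

lemma IsIsotropicStable.tendsto_comp_dyadicAbove (hS : IsIsotropicStable β S P) :
    ∀ᵐ ω ∂P, Tendsto (fun k => S (dyadicAbove k ⌊2 ^ k * T ω⌋₊) ω) atTop (𝓝 (S (T ω) ω)) := by
  filter_upwards [hS.levy.cadlag] with ω hω
  exact (hω (T ω)).1.tendsto.comp (tendsto_dyadicAbove_floor (T ω))

lemma IsIsotropicStable.aemeasurable_comp (hS : IsIsotropicStable β S P) (hT : Measurable T) :
    AEMeasurable (fun ω => S (T ω) ω) P :=
  aemeasurable_of_tendsto_metrizable_ae atTop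
    (fun k => (measurable_comp_dyadicAbove hS.levy.measurable hT k).aemeasurable)
    hS.tendsto_comp_dyadicAbove

/-- Bochner subordination: the characteristic function of `S` at an independent random time. -/
lemma IsIsotropicStable.charFun_comp [IsProbabilityMeasure P] (hS : IsIsotropicStable β S P)
    (hT : Measurable T) (hind : IndepFun (fun ω s => S s ω) T P)
    (ξ : EuclideanSpace ℝ (Fin n)) :
    charFun (P.map fun ω => S (T ω) ω) ξ
      = ((∫ ω, Real.exp (-(‖ξ‖ ^ (2 * β) * T ω)) ∂P : ℝ) : ℂ) := by
  have hSm := hS.levy.measurable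
  have hSm' : Measurable fun ω s => S s ω := measurable_pi_iff.2 hSm
  set N : ℕ → Ω → ℕ := fun k ω => ⌊2 ^ k * T ω⌋₊ with hN
  have hNm : ∀ k, Measurable (N k) := fun k => Nat.measurable_floor.comp (by fun_prop)
  set e : EuclideanSpace ℝ (Fin n) → ℂ := fun x => Complex.exp (inner ℝ x ξ * Complex.I) with he
  have hec : Continuous e := by fun_prop
  have hen : ∀ x, ‖e x‖ = 1 := fun x => Complex.norm_exp_ofReal_mul_I _
  -- For a discrete independent time, Fubini freezes the time and only the characteristic functions
  -- at fixed times enter. Right-continuity and dominated convergence then pass to T.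
  have hdisc : ∀ k, ∫ ω, e (S (dyadicAbove k (N k ω)) ω) ∂P
      = ∫ ω, ((Real.exp (-(‖ξ‖ ^ (2 * β) * dyadicAbove k (N k ω))) : ℝ) : ℂ) ∂P := by
    intro k
    have hindk : IndepFun (fun ω s => S s ω) (N k) P :=
      hind.comp measurable_id (Nat.measurable_floor.comp (by fun_prop : Measurable fun x : ℝ≥0 =>
        2 ^ k * x))
    have hprod := hindk.map_prod_eq_prod_map_map hSm'.aemeasurable (hNm k).aemeasurable
    set F : (ℝ≥0 → EuclideanSpace ℝ (Fin n)) × ℕ → ℂ := fun p => e (p.1 (dyadicAbove k p.2)) with hF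
    have hFm : Measurable F := measurable_from_prod_countable_left fun j => by
      simp only [hF]
      fun_prop
    have : IsProbabilityMeasure (P.map fun ω s => S s ω) :=
      Measure.isProbabilityMeasure_map hSm'.aemeasurable
    have : IsProbabilityMeasure (P.map (N k)) :=
      Measure.isProbabilityMeasure_map (hNm k).aemeasurable
    have hFi : Integrable F ((P.map fun ω s => S s ω).prod (P.map (N k))) :=
      Integrable.of_bound hFm.aestronglyMeasurable 1 (ae_of_all _ fun p => (hen _).le)
    have h1 : ∫ ω, e (S (dyadicAbove k (N k ω)) ω) ∂P
        = ∫ p, F p ∂(P.map fun ω s => S s ω).prod (P.map (N k)) := by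
      rw [← hprod, integral_map (hSm'.prodMk (hNm k)).aemeasurable hFm.aestronglyMeasurable]
    rw [h1, integral_prod_symm _ hFi, integral_map (hNm k).aemeasurable
      (measurable_from_top.aestronglyMeasurable)]
    refine integral_congr_ae (ae_of_all _ fun ω => ?_)
    simp only [hF]
    rw [integral_map hSm'.aemeasurable (Measurable.aestronglyMeasurable (by fun_prop))]
    have h2 := hS.charFun_eq (dyadicAbove k (N k ω)) ξ
    rw [charFun_apply, integral_map (hSm _).aemeasurable hec.aestronglyMeasurable] at h2
    rw [h2, Complex.ofReal_exp]
    congr 1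
    push_cast
    ring
  have hlim1 : Tendsto (fun k => ∫ ω, e (S (dyadicAbove k (N k ω)) ω) ∂P) atTop
      (𝓝 (∫ ω, e (S (T ω) ω) ∂P)) := by
    refine tendsto_integral_of_dominated_convergence (fun _ => 1) (fun k => ?_)
      (integrable_const 1) (fun k => ae_of_all _ fun ω => (hen _).le) ?_
    · exact (hec.measurable.comp (measurable_comp_dyadicAbove hSm hT k)).aestronglyMeasurable
    · filter_upwards [hS.tendsto_comp_dyadicAbove (T := T)] with ω hω
      exact (hec.tendsto _).comp hω
  have hlim2 : Tendsto (fun k => ∫ ω, ((Real.exp (-(‖ξ‖ ^ (2 * β) * dyadicAbove k (N k ω))) : ℝ) : ℂ)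
      ∂P) atTop (𝓝 (∫ ω, ((Real.exp (-(‖ξ‖ ^ (2 * β) * T ω)) : ℝ) : ℂ) ∂P)) := by
    refine tendsto_integral_of_dominated_convergence (fun _ => 1) (fun k => ?_)
      (integrable_const 1) (fun k => ae_of_all _ fun ω => ?_) (ae_of_all _ fun ω => ?_)
    · have : Measurable fun ω => dyadicAbove k (N k ω) :=
        (measurable_from_top (f := dyadicAbove k)).comp (hNm k)
      exact Measurable.aestronglyMeasurable (by fun_prop)
    · rw [Complex.norm_real, Real.norm_eq_abs, abs_of_pos (Real.exp_pos _), Real.exp_le_one_iff]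
      have : 0 ≤ ‖ξ‖ ^ (2 * β) := by positivity
      exact neg_nonpos.2 (mul_nonneg this (NNReal.coe_nonneg _))
    · have h3 : Tendsto (fun k => dyadicAbove k (N k ω)) atTop (𝓝 (T ω)) :=
        (tendsto_dyadicAbove_floor (T ω)).mono_right nhdsWithin_le_nhds
      have hc : Continuous fun x : ℝ≥0 => ((Real.exp (-(‖ξ‖ ^ (2 * β) * x)) : ℝ) : ℂ) := by fun_prop
      exact (hc.tendsto _).comp h3
  simp_rw [hdisc] at hlim1
  rw [charFun_apply, integral_map (hS.aemeasurable_comp hT) hec.aestronglyMeasurable,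
    tendsto_nhds_unique hlim1 hlim2, integral_complex_ofReal]

end Subordination

/-! ### The composed process and its characteristic function. -/

section Composed

variable {n : ℕ} {α ν β c lam : ℝ} {Ω : Type*} [MeasurableSpace Ω] {P : Measure Ω}
  [IsProbabilityMeasure P] {S : ℝ≥0 → Ω → EuclideanSpace ℝ (Fin n)} {H₁ H₂ : ℝ≥0 → Ω → ℝ}

/-- The composed process at time `t` is a.s. `S` at a measurable time independent of `S`. -/
lemma exists_independent_time (hν : 0 < ν) (hlam : 0 < lam)
    (hH₁ : IsStableSubordinator α H₁ P) (hH₂ : IsStableSubordinator ν H₂ P)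
    (hindH : IndepFun (fun ω t => H₁ t ω) (fun ω t => H₂ t ω) P)
    (hindS : IndepFun (fun ω t => S t ω) (fun ω => (fun t => H₁ t ω, fun t => H₂ t ω)) P) (t : ℝ) :
    ∃ T : Ω → ℝ≥0, Measurable T ∧ IndepFun (fun ω s => S s ω) T P ∧
      T =ᵐ[P] fun ω => Real.toNNReal (c ^ 2)
        * inverseProcess (combinedSubordinator lam ν H₁ H₂) t ω := by
  have hH := hasLaplaceExponent_combinedSubordinator hν hlam hH₁ hH₂ hindH
  set Λ : (ℝ≥0 → ℝ) × (ℝ≥0 → ℝ) → ℝ≥0 := fun p => Real.toNNReal (c ^ 2)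
    * ratPassage t fun s => p.1 s + (2 * lam) ^ (1 / ν) * p.2 s with hΛ
  have hΛm : Measurable Λ := by
    refine ((measurable_ratPassage t).comp (measurable_pi_iff.2 fun s => ?_)).const_mul _
    fun_prop
  have hm : Measurable fun ω => ((fun t => H₁ t ω, fun t => H₂ t ω) :
      (ℝ≥0 → ℝ) × (ℝ≥0 → ℝ)) :=
    (measurable_pi_iff.2 hH₁.levy.measurable).prodMk (measurable_pi_iff.2 hH₂.levy.measurable)
  refine ⟨_, hΛm.comp hm, hindS.comp measurable_id hΛm, ?_⟩
  filter_upwards [hH.monotone, hH.ae_unbounded (symbol_pos (by positivity) one_pos)] with ω h1 h2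
  rw [inverseProcess_eq_ratPassage h1 h2]
  rfl

lemma aemeasurable_composedProcess (hν : 0 < ν) (hlam : 0 < lam) (hS : IsIsotropicStable β S P)
    (hH₁ : IsStableSubordinator α H₁ P) (hH₂ : IsStableSubordinator ν H₂ P)
    (hindH : IndepFun (fun ω t => H₁ t ω) (fun ω t => H₂ t ω) P)
    (hindS : IndepFun (fun ω t => S t ω) (fun ω => (fun t => H₁ t ω, fun t => H₂ t ω)) P) (t : ℝ) :
    AEMeasurable (composedProcess c lam ν S H₁ H₂ t) P := by
  obtain ⟨T, hTm, -, hT⟩ := exists_independent_time (c := c) hν hlam hH₁ hH₂ hindH hindS t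
  refine (hS.aemeasurable_comp hTm).congr ?_
  filter_upwards [hT] with ω hω
  rw [hω, composedProcess]

lemma charFun_composedProcess (hν : 0 < ν) (hlam : 0 < lam) (hS : IsIsotropicStable β S P)
    (hH₁ : IsStableSubordinator α H₁ P) (hH₂ : IsStableSubordinator ν H₂ P)
    (hindH : IndepFun (fun ω t => H₁ t ω) (fun ω t => H₂ t ω) P)
    (hindS : IndepFun (fun ω t => S t ω) (fun ω => (fun t => H₁ t ω, fun t => H₂ t ω)) P) (t : ℝ)
    (ξ : EuclideanSpace ℝ (Fin n)) :
    charFun (P.map (composedProcess c lam ν S H₁ H₂ t)) ξ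
      = ((∫ ω, Real.exp (-(c ^ 2 * ‖ξ‖ ^ (2 * β)
          * inverseProcess (combinedSubordinator lam ν H₁ H₂) t ω)) ∂P : ℝ) : ℂ) := by
  obtain ⟨T, hTm, hTi, hT⟩ := exists_independent_time (c := c) hν hlam hH₁ hH₂ hindH hindS t
  have h1 : P.map (composedProcess c lam ν S H₁ H₂ t) = P.map fun ω => S (T ω) ω := by
    refine Measure.map_congr ?_
    filter_upwards [hT] with ω hω
    rw [hω, composedProcess]
  rw [h1, hS.charFun_comp hTm hTi]
  congr 1
  refine integral_congr_ae ?_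
  filter_upwards [hT] with ω hω
  rw [hω, NNReal.coe_mul, Real.coe_toNNReal _ (sq_nonneg c)]
  ring_nf

end Composed

/-! ### Caputo derivatives as integrals against kernel measures. -/

section Caputo

variable {γ t : ℝ}

/-- Cutting u' off at 0 lets the kernel be integrated over the whole half-line: the range (0, t)
arises from the two indicators. -/
lemma indicator_caputo_density_smul (v : ℝ → ℂ) (t : ℝ) :
    ((Ioi (0 : ℝ)).indicator fun s => (ENNReal.ofReal
      (1 / Real.Gamma (1 - γ) * s ^ (-γ))).toReal • (Ioi 0).indicator v (t - s))
    = (Ioo 0 t).indicator fun s => (ENNReal.ofReal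
      (1 / Real.Gamma (1 - γ) * s ^ (-γ))).toReal • v (t - s) := by
  ext s
  by_cases h0 : 0 < s <;> by_cases h1 : s < t <;> simp [indicator, h0, h1]

lemma caputo_density_eqOn (hγ : γ < 1) (v : ℝ → ℂ) (t : ℝ) :
    EqOn (fun s => (ENNReal.ofReal (1 / Real.Gamma (1 - γ) * s ^ (-γ))).toReal • v (t - s))
      (fun s => (1 / Real.Gamma (1 - γ)) • (s ^ (-γ) • v (t - s))) (Ioo 0 t) := by
  intro s hs
  have hs0 : 0 < s := hs.1
  have hG := Real.Gamma_pos_of_pos (sub_pos.2 hγ)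
  simp only
  rw [ENNReal.toReal_ofReal (by positivity), mul_smul]

/-- Integrability against the Caputo kernel measure. -/
lemma integrable_caputoKernel_iff (hγ : γ < 1) (ht : 0 < t) (v : ℝ → ℂ) :
    Integrable (fun s => (Ioi 0).indicator v (t - s)) (caputoKernel γ) ↔
      IntervalIntegrable (fun s => (t - s) ^ (-γ) • v s) volume 0 t := by
  have hG := Real.Gamma_pos_of_pos (sub_pos.2 hγ)
  rw [caputoKernel, if_neg hγ.ne, integrable_withDensity_iff_integrable_smul' (by fun_prop) (by simp),
    ← IntegrableOn, ← integrable_indicator_iff measurableSet_Ioi, indicator_caputo_density_smul,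
    integrable_indicator_iff measurableSet_Ioo,
    integrableOn_congr_fun (caputo_density_eqOn hγ v t) measurableSet_Ioo,
    IntegrableOn, integrable_fun_smul_iff (by positivity), ← IntegrableOn,
    ← intervalIntegrable_iff_integrableOn_Ioo_of_le ht.le]
  constructor <;> intro h
  · have := (h.comp_sub_left t enorm_ne_top).symm
    simpa using this
  · have := (h.comp_sub_left t enorm_ne_top).symm
    simpa using this

/-- The Caputo derivative as an integral against the Caputo kernel measure. -/
lemma caputoDeriv_eq_integral (hγ : γ ≤ 1) (ht : 0 < t) (u : ℝ → ℂ) :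
    caputoDeriv γ u t = ∫ s, (Ioi 0).indicator (deriv u) (t - s) ∂caputoKernel γ := by
  unfold caputoDeriv caputoKernel
  split_ifs with h
  · simp [ht]
  · have hγ' : γ < 1 := lt_of_le_of_ne hγ h
    rw [integral_withDensity_eq_integral_toReal_smul (by fun_prop) (by simp),
      ← integral_indicator measurableSet_Ioi, indicator_caputo_density_smul,
      integral_indicator measurableSet_Ioo,
      setIntegral_congr_fun measurableSet_Ioo (caputo_density_eqOn hγ' (deriv u) t),
      integral_smul, ← integral_Ioc_eq_integral_Ioo, ← intervalIntegral.integral_of_le ht.le]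
    congr 1
    have := intervalIntegral.integral_comp_sub_left (a := 0) (b := t)
      (fun s => (t - s) ^ (-γ) • deriv u s) t
    simpa using this.symm

lemma HasCaputoDeriv.integrable_caputoKernel {u : ℝ → ℂ} (hu : HasCaputoDeriv γ u) (hγ : γ ≤ 1)
    (ht : 0 < t) :
    Integrable (fun s => (Ioi 0).indicator (deriv u) (t - s)) (caputoKernel γ) := by
  rcases hγ.eq_or_lt with h | h
  · rw [caputoKernel, if_pos h]
    exact integrable_dirac (by simp)
  · exact (integrable_caputoKernel_iff h ht _).2 (hu.integrable_kernel h t ht)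

end Caputo

/-! ### Fourier inversion and the symbol of the fractional Laplacian. -/

section Fourier

variable {n : ℕ}

local notation "E" => EuclideanSpace ℝ (Fin n)

/-- Parseval's identity for a finite measure and an inverse Fourier transform. -/
lemma integral_fourierInv_eq (μ : Measure E) [IsFiniteMeasure μ] {g : E → ℂ} (hg : Integrable g) :
    ∫ x, 𝓕⁻ g x ∂μ = ∫ ξ, g ξ * charFun μ ((2 * Real.pi) • ξ) := by
  simp_rw [Real.fourierInv_eq']
  rw [integral_integral_swap]
  · refine integral_congr_ae (ae_of_all _ fun ξ => ?_)
    simp only [charFun_apply, smul_eq_mul]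
    rw [integral_mul_const, mul_comm]
    congr 1
    refine integral_congr_ae (ae_of_all _ fun x => ?_)
    simp only [inner_smul_right, real_inner_comm]
  · have h1 : Integrable (fun p : E × E => g p.2) (μ.prod volume) := hg.comp_snd μ
    refine h1.mono ?_ (ae_of_all _ fun p => ?_)
    · have hc : Continuous fun p : E × E =>
          Complex.exp (((2 * Real.pi * inner ℝ p.2 p.1 : ℝ) : ℂ) * Complex.I) := by fun_prop
      exact hc.aestronglyMeasurable.smul h1.aestronglyMeasurable
    · simp only [Function.uncurry, norm_smul, Complex.norm_exp_ofReal_mul_I, one_mul, le_refl]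

/-- The symbol of `(-Δ)^β`. -/
noncomputable def fracSymbol (β : ℝ) (ξ : E) : ℝ := (2 * Real.pi * ‖ξ‖) ^ (2 * β)

lemma continuous_fracSymbol {β : ℝ} (hβ : 0 < β) : Continuous (fracSymbol (n := n) β) := by
  unfold fracSymbol
  exact (continuous_const.mul continuous_norm).rpow_const fun _ => Or.inr (by positivity)

lemma fracSymbol_nonneg (β : ℝ) (ξ : E) : 0 ≤ fracSymbol β ξ := by
  unfold fracSymbol; positivity

lemma fracSymbol_le {β : ℝ} (hβ : β ∈ Ioc (0 : ℝ) 1) (ξ : E) :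
    fracSymbol β ξ ≤ 1 + (2 * Real.pi * ‖ξ‖) ^ 2 := by
  unfold fracSymbol
  have h0 : 0 ≤ 2 * Real.pi * ‖ξ‖ := by positivity
  have hb := hβ.1
  rcases le_total (2 * Real.pi * ‖ξ‖) 1 with h | h
  · have := Real.rpow_le_one h0 h (by positivity : 0 ≤ 2 * β)
    nlinarith [sq_nonneg (2 * Real.pi * ‖ξ‖)]
  · have := Real.rpow_le_rpow_of_exponent_le h (by linarith [hβ.2] : 2 * β ≤ 2)
    rw [Real.rpow_two] at this
    linarith

lemma integrable_fracSymbol_mul {β : ℝ} (hβ : β ∈ Ioc (0 : ℝ) 1) (f : 𝓢(E, ℂ)) :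
    Integrable fun ξ => fracSymbol β ξ • f ξ := by
  have h2 := f.integrable_pow_mul volume 2
  have hbound : Integrable fun ξ : E => ‖f ξ‖ + (2 * Real.pi) ^ 2 * (‖ξ‖ ^ 2 * ‖f ξ‖) :=
    f.integrable.norm.add (h2.const_mul _)
  refine hbound.mono' ?_ (ae_of_all _ fun ξ => ?_)
  · exact ((continuous_fracSymbol hβ.1).smul f.continuous).aestronglyMeasurable
  · rw [norm_smul, Real.norm_eq_abs, abs_of_nonneg (fracSymbol_nonneg β ξ)]
    calc fracSymbol β ξ * ‖f ξ‖ ≤ (1 + (2 * Real.pi * ‖ξ‖) ^ 2) * ‖f ξ‖ :=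
          mul_le_mul_of_nonneg_right (fracSymbol_le hβ ξ) (norm_nonneg _)
      _ = _ := by ring

/-- Converts the frequency 2πξ of characteristic functions into the 2π-normalised Fourier variable.
-/
lemma fracSymbol_eq_norm_smul (β : ℝ) (ξ : E) :
    fracSymbol β ξ = ‖(2 * Real.pi) • ξ‖ ^ (2 * β) := by
  rw [fracSymbol, norm_smul, Real.norm_eq_abs, abs_of_pos Real.two_pi_pos]

lemma fracLaplacian_eq (β : ℝ) (φ : E → ℂ) :
    fracLaplacian β φ = 𝓕⁻ (fun ξ => fracSymbol β ξ • 𝓕 φ ξ) := rfl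

end Fourier

/-! ### Relaxation functions and their superpositions. -/

/-- The relaxation functions `m κ` of the operator `∂ᵗ^α + a ∂ᵗ^ν`: the solutions of the scalar
equations `(∂ᵗ^α + a ∂ᵗ^ν) m = -κ m`, `m(0) = 1`, with derivatives `-p κ`. -/
structure IsRelaxation (α ν a : ℝ) (m p : ℝ → ℝ → ℝ) : Prop where
  measurable_left : ∀ t, Measurable fun κ => m κ t
  nonneg : ∀ κ, 0 ≤ κ → ∀ t, 0 ≤ m κ t
  deriv_measurable : ∀ κ, 0 ≤ κ → Measurable (p κ)
  deriv_nonneg : ∀ κ, 0 ≤ κ → ∀ t, 0 ≤ p κ t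
  deriv_eq_zero : ∀ κ, 0 ≤ κ → ∀ t ≤ 0, p κ t = 0
  deriv_continuousOn : ∀ κ, 0 ≤ κ → ContinuousOn (p κ) (Ioi 0)
  deriv_integrableOn : ∀ κ, 0 ≤ κ → ∀ t, IntegrableOn (p κ) (Iic t)
  eq_integral : ∀ κ, 0 ≤ κ → ∀ t, m κ t = 1 - ∫ s in Iic t, p κ s
  deriv_le : ∀ κ, 0 ≤ κ → ∀ t, 0 < t → p κ t ≤ 1 / t
  integrable_left : ∀ κ, 0 ≤ κ → ∀ t, 0 < t → Integrable (fun s => p κ (t - s)) (caputoKernel α)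
  integrable_right : ∀ κ, 0 ≤ κ → ∀ t, 0 < t → Integrable (fun s => p κ (t - s)) (caputoKernel ν)
  equation : ∀ κ, 0 ≤ κ → ∀ t, 0 < t → ∫ s, p κ (t - s) ∂caputoKernel α
    + a * ∫ s, p κ (t - s) ∂caputoKernel ν = κ * m κ t

/-- The Laplace transforms of the inverse process are relaxation functions. -/
lemma HasLaplaceExponent.exists_isRelaxation {Ω : Type*} [MeasurableSpace Ω] {P : Measure Ω}
    [IsProbabilityMeasure P] {α ν a : ℝ} {H : ℝ≥0 → Ω → ℝ}
    (hH : HasLaplaceExponent (symbol α ν a) H P) (hα : α ∈ Ioc (0 : ℝ) 1)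
    (hν : ν ∈ Ioc (0 : ℝ) 1) (ha : 0 < a) :
    ∃ p, IsRelaxation α ν a (fun κ t => ∫ ω, Real.exp (-(κ * inverseProcess H t ω)) ∂P) p := by
  have hψ : 0 < symbol α ν a 1 := symbol_pos ha one_pos
  have hpot : ∀ κ, 0 ≤ κ → IsPotential α ν a κ (potentialMeasure κ H P) := fun κ hκ =>
    hH.isPotential ha hκ
  -- `choose` needs a density for every real κ; negative κ receive a dummy.
  have hex : ∀ κ, ∃ r, 0 ≤ κ → IsPotentialDensity α ν a κ (potentialMeasure κ H P) r := by
    intro κ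
    by_cases hκ : 0 ≤ κ
    · obtain ⟨r, hr⟩ := (hpot κ hκ).exists_isPotentialDensity hα hν ha hκ
      exact ⟨r, fun _ => hr⟩
    · exact ⟨0, fun h => absurd h hκ⟩
  choose r hr using hex
  have hm : ∀ κ, 0 ≤ κ → ∀ t, ∫ ω, Real.exp (-(κ * inverseProcess H t ω)) ∂P
      = 1 - κ * (potentialMeasure κ H P).real (Iic t) := fun κ hκ t =>
    integral_exp_inverseProcess hH hψ hκ t
  have hU : ∀ κ, 0 ≤ κ → ∀ t, (potentialMeasure κ H P).real (Iic t) = ∫ s in Iic t, r κ s := by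
    intro κ hκ t
    rw [Measure.real, (hr κ hκ).withDensity_eq, withDensity_apply _ measurableSet_Iic,
      integral_eq_lintegral_of_nonneg_ae (ae_of_all _ (hr κ hκ).nonneg)
      (hr κ hκ).measurable.aestronglyMeasurable]
  refine ⟨fun κ t => κ * r κ t, ?_, ?_, ?_, ?_, ?_, ?_, ?_, ?_, ?_, ?_, ?_, ?_⟩
  · intro t
    set R : Ω → ℝ≥0 := fun ω => ratPassage t fun s => H s ω with hR
    have hRm : Measurable fun ω => (R ω : ℝ) :=
      ((measurable_ratPassage t).comp (measurable_pi_iff.2 hH.measurable)).coe_nnreal_real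
    have hlaw : ∀ κ, ∫ ω, Real.exp (-(κ * inverseProcess H t ω)) ∂P
        = ∫ ω, Real.exp (-(κ * R ω)) ∂P := by
      intro κ
      refine integral_congr_ae ?_
      filter_upwards [hH.monotone, hH.ae_unbounded hψ] with ω h1 h2
      rw [inverseProcess_eq_ratPassage h1 h2]
    simp_rw [hlaw]
    have hexp : Measurable fun q : ℝ × Ω => Real.exp (-(q.1 * R q.2)) :=
      (measurable_fst.mul (hRm.comp measurable_snd)).neg.exp
    exact (StronglyMeasurable.integral_prod_right (f := fun κ ω => Real.exp (-(κ * R ω)))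
      hexp.stronglyMeasurable).measurable
  · exact fun κ _ t => integral_nonneg fun ω => (Real.exp_pos _).le
  · exact fun κ hκ => (hr κ hκ).measurable.const_mul κ
  · exact fun κ hκ t => mul_nonneg hκ ((hr κ hκ).nonneg t)
  · intro κ hκ t ht
    rw [(hr κ hκ).eq_zero t ht, mul_zero]
  · exact fun κ hκ => continuousOn_const.mul (hr κ hκ).continuousOn
  · exact fun κ hκ t => ((hr κ hκ).integrableOn t).const_mul κ
  · intro κ hκ t
    rw [hm κ hκ, hU κ hκ, integral_const_mul]
  · exact fun κ hκ t ht => (hr κ hκ).bound t ht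
  · exact fun κ hκ t ht => ((hr κ hκ).integrable_left t ht).const_mul κ
  · exact fun κ hκ t ht => ((hr κ hκ).integrable_right t ht).const_mul κ
  · intro κ hκ t ht
    have h1 := (hr κ hκ).resolvent t ht
    -- First passage gives the closed half-line and the resolvent identity the open one; they agree
    -- because U has a density.
    have h2 : (potentialMeasure κ H P).real (Iic t) = (potentialMeasure κ H P).real (Iio t) := by
      have : (potentialMeasure κ H P) {t} = 0 := by
        rw [(hr κ hκ).withDensity_eq]
        exact withDensity_absolutelyContinuous _ _ (measure_singleton t)
      rw [Measure.real, Measure.real, measure_congr (Iio_ae_eq_Iic' this)]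
    rw [hm κ hκ, h2, ← h1, integral_const_mul, integral_const_mul]
    ring

namespace IsRelaxation

variable {α ν a : ℝ} {m p : ℝ → ℝ → ℝ} {κ : ℝ}

lemma intervalIntegrable (h : IsRelaxation α ν a m p) (hκ : 0 ≤ κ) (x y : ℝ) :
    IntervalIntegrable (p κ) volume x y :=
  ⟨(h.deriv_integrableOn κ hκ y).mono_set Ioc_subset_Iic_self,
    (h.deriv_integrableOn κ hκ x).mono_set Ioc_subset_Iic_self⟩

lemma eq_one_sub (h : IsRelaxation α ν a m p) (hκ : 0 ≤ κ) (t : ℝ) :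
    m κ t = 1 - ∫ s in (0 : ℝ)..t, p κ s := by
  rw [h.eq_integral κ hκ, ← intervalIntegral.integral_Iic_sub_Iic (h.deriv_integrableOn κ hκ 0)
    (h.deriv_integrableOn κ hκ t), setIntegral_congr_fun (g := fun _ => 0) measurableSet_Iic
    (h.deriv_eq_zero κ hκ)]
  simp

lemma apply_zero (h : IsRelaxation α ν a m p) (hκ : 0 ≤ κ) : m κ 0 = 1 := by
  simp [h.eq_one_sub hκ]

lemma le_one (h : IsRelaxation α ν a m p) (hκ : 0 ≤ κ) (t : ℝ) : m κ t ≤ 1 := by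
  rw [h.eq_integral κ hκ]
  have : 0 ≤ ∫ s in Iic t, p κ s := integral_nonneg fun s => h.deriv_nonneg κ hκ s
  linarith

lemma continuous (h : IsRelaxation α ν a m p) (hκ : 0 ≤ κ) : Continuous (m κ) := by
  rw [funext (h.eq_one_sub hκ)]
  exact continuous_const.sub (intervalIntegral.continuous_primitive (h.intervalIntegrable hκ) 0)

lemma hasDerivAt (h : IsRelaxation α ν a m p) (hκ : 0 ≤ κ) {t : ℝ} (ht : 0 < t) :
    HasDerivAt (m κ) (-p κ t) t := by
  rw [funext (h.eq_one_sub hκ)]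
  exact (intervalIntegral.integral_hasDerivAt_right (h.intervalIntegrable hκ 0 t)
    (h.deriv_measurable κ hκ).stronglyMeasurable.stronglyMeasurableAtFilter
    ((h.deriv_continuousOn κ hκ).continuousAt (Ioi_mem_nhds ht))).const_sub 1

section Superposition

variable {X : Type*} [MeasurableSpace X] {k : X → ℝ}

lemma measurable_uncurry (h : IsRelaxation α ν a m p) (hk : Measurable k) (hk0 : ∀ x, 0 ≤ k x) :
    Measurable fun q : ℝ × X => m (k q.2) q.1 :=
  measurable_uncurry_of_continuous_of_measurable (u := fun t x => m (k x) t)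
    (fun x => h.continuous (hk0 x)) fun t => (h.measurable_left t).comp hk

/-- Joint measurability, needed for Fubini, is inherited from m: p is the pointwise limit of its
negated difference quotients. The indicator confines these to t > 0, where differentiability is
available. -/
lemma measurable_uncurry_deriv (h : IsRelaxation α ν a m p) (hk : Measurable k)
    (hk0 : ∀ x, 0 ≤ k x) : Measurable fun q : ℝ × X => p (k q.2) q.1 := by
  set D : ℕ → ℝ × X → ℝ := fun N q => (Ioi (0 : ℝ) ×ˢ (univ : Set X)).indicator
    (fun q => ((1 : ℝ) / (N + 1))⁻¹ * (m (k q.2) q.1 - m (k q.2) (q.1 + 1 / (N + 1)))) q with hD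
  have hm := h.measurable_uncurry hk hk0
  have hDm : ∀ N, Measurable (D N) := by
    intro N
    refine Measurable.indicator ?_ (measurableSet_Ioi.prod MeasurableSet.univ)
    refine (hm.sub ?_).const_mul _
    exact hm.comp (g := fun q : ℝ × X => m (k q.2) q.1)
      (f := fun q : ℝ × X => (q.1 + 1 / ((N : ℝ) + 1), q.2)) (by fun_prop)
  refine measurable_of_tendsto_metrizable hDm (tendsto_pi_nhds.2 fun q => ?_)
  rcases le_or_gt q.1 0 with hq | hq
  · simp [hD, h.deriv_eq_zero _ (hk0 q.2) _ hq, not_lt.2 hq]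
  · have hs := (h.hasDerivAt (hk0 q.2) hq).tendsto_slope_zero_right
    have hN : Tendsto (fun N : ℕ => 1 / ((N : ℝ) + 1)) atTop (𝓝[>] 0) :=
      tendsto_nhdsWithin_iff.2 ⟨tendsto_one_div_add_atTop_nhds_zero_nat,
        Eventually.of_forall fun N => by simp only [mem_Ioi]; positivity⟩
    have := (hs.comp hN).neg
    rw [neg_neg] at this
    refine this.congr fun N => ?_
    simp only [Function.comp_apply, hD, smul_eq_mul]
    rw [indicator_of_mem (by simpa using hq)]
    ring

variable {μ : Measure X} {f : X → ℂ}

lemma continuous_superposition (h : IsRelaxation α ν a m p) (hk : Measurable k)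
    (hk0 : ∀ x, 0 ≤ k x) (hf : Integrable f μ) :
    Continuous fun t => ∫ x, f x * (m (k x) t : ℂ) ∂μ := by
  refine continuous_of_dominated (bound := fun x => ‖f x‖) (fun t => ?_) (fun t => ?_) hf.norm ?_
  · exact hf.aestronglyMeasurable.mul (Complex.measurable_ofReal.comp
      ((h.measurable_left t).comp hk)).aestronglyMeasurable
  · refine ae_of_all _ fun x => ?_
    rw [norm_mul, Complex.norm_real, Real.norm_eq_abs, abs_of_nonneg (h.nonneg _ (hk0 x) t)]
    exact mul_le_of_le_one_right (norm_nonneg _) (h.le_one (hk0 x) t)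
  · exact ae_of_all _ fun x => continuous_const.mul
      (Complex.continuous_ofReal.comp (h.continuous (hk0 x)))

/-- The bound p κ s ≤ 1/s is uniform in κ, so on (t/2, ∞) the derivatives are dominated by (2/t)‖f‖.
-/
lemma hasDerivAt_superposition (h : IsRelaxation α ν a m p) (hk : Measurable k)
    (hk0 : ∀ x, 0 ≤ k x) (hf : Integrable f μ) {t : ℝ} (ht : 0 < t) :
    HasDerivAt (fun t => ∫ x, f x * (m (k x) t : ℂ) ∂μ)
      (∫ x, f x * (-(p (k x) t : ℂ)) ∂μ) t := by
  have hpm : Measurable fun x => (p (k x) t : ℂ) := Complex.measurable_ofReal.comp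
    ((h.measurable_uncurry_deriv hk hk0).comp (measurable_const.prodMk measurable_id))
  have hmm : ∀ s, AEStronglyMeasurable (fun x => f x * (m (k x) s : ℂ)) μ := fun s =>
    hf.aestronglyMeasurable.mul (Complex.measurable_ofReal.comp
      ((h.measurable_left s).comp hk)).aestronglyMeasurable
  refine (hasDerivAt_integral_of_dominated_loc_of_deriv_le (s := Ioi (t / 2))
    (F' := fun t x => f x * (-(p (k x) t : ℂ))) (bound := fun x => ‖f x‖ * (2 / t))
    (Ioi_mem_nhds (half_lt_self ht)) (Eventually.of_forall hmm)
    ?_ ?_ ?_ (hf.norm.mul_const _) ?_).2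
  · refine hf.mono (hmm t) (ae_of_all _ fun x => ?_)
    rw [norm_mul, Complex.norm_real, Real.norm_eq_abs, abs_of_nonneg (h.nonneg _ (hk0 x) t)]
    exact mul_le_of_le_one_right (norm_nonneg _) (h.le_one (hk0 x) t)
  · exact hf.aestronglyMeasurable.mul hpm.neg.aestronglyMeasurable
  · refine ae_of_all _ fun x s hs => ?_
    have hs0 : 0 < s := (by positivity : 0 < t / 2).trans hs
    rw [norm_mul, norm_neg, Complex.norm_real, Real.norm_eq_abs,
      abs_of_nonneg (h.deriv_nonneg _ (hk0 x) s)]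
    refine mul_le_mul_of_nonneg_left ((h.deriv_le _ (hk0 x) s hs0).trans ?_) (norm_nonneg _)
    rw [show (2 : ℝ) / t = 1 / (t / 2) by field_simp]
    exact one_div_le_one_div_of_le (by positivity) (le_of_lt hs)
  · refine ae_of_all _ fun x s hs => ?_
    have hs0 : 0 < s := (by positivity : 0 < t / 2).trans hs
    have := (h.hasDerivAt (hk0 x) hs0).ofReal_comp.const_mul (f x)
    simpa using this

lemma indicator_deriv_superposition (h : IsRelaxation α ν a m p) (hk : Measurable k)
    (hk0 : ∀ x, 0 ≤ k x) (hf : Integrable f μ) {u : ℝ → ℂ}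
    (hu : ∀ t, 0 ≤ t → u t = ∫ x, f x * (m (k x) t : ℂ) ∂μ) :
    (Ioi 0).indicator (deriv u) = fun t => ∫ x, f x * (-(p (k x) t : ℂ)) ∂μ := by
  ext t
  rcases le_or_gt t 0 with ht | ht
  · simp [not_lt.2 ht, fun x => h.deriv_eq_zero _ (hk0 x) t ht]
  · rw [indicator_of_mem (by exact ht)]
    refine ((h.hasDerivAt_superposition hk hk0 hf ht).congr_of_eventuallyEq ?_).deriv
    filter_upwards [Ioi_mem_nhds ht] with s hs
    exact hu s (le_of_lt hs)

/-- Integrability of the superposed derivatives against a measure in time. -/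
lemma integrable_prod_superposition [SFinite μ] (h : IsRelaxation α ν a m p) (hk : Measurable k)
    (hk0 : ∀ x, 0 ≤ k x) (hf : Integrable f μ) {K : Measure ℝ} [SFinite K] {g : ℝ → ℝ}
    (hg : Measurable g) (hi : ∀ x, Integrable (fun s => p (k x) (g s)) K) {b : X → ℝ}
    (hb : ∀ x, ∫ s, p (k x) (g s) ∂K ≤ b x) (hfb : Integrable (fun x => b x • f x) μ) :
    Integrable (fun q : X × ℝ => f q.1 * (-(p (k q.1) (g q.2) : ℂ))) (μ.prod K) := by
  have hpm : Measurable fun q : X × ℝ => (p (k q.1) (g q.2) : ℂ) := Complex.measurable_ofReal.comp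
    ((h.measurable_uncurry_deriv hk hk0).comp
      ((hg.comp measurable_snd).prodMk measurable_fst))
  have hmeas : AEStronglyMeasurable (fun q : X × ℝ => f q.1 * (-(p (k q.1) (g q.2) : ℂ)))
      (μ.prod K) := hf.aestronglyMeasurable.comp_fst.mul hpm.neg.aestronglyMeasurable
  rw [integrable_prod_iff hmeas]
  have hix : ∀ x, Integrable (fun s => f x * (-(p (k x) (g s) : ℂ))) K := fun x =>
    ((hi x).ofReal (𝕜 := ℂ)).neg.const_mul (f x)
  refine ⟨ae_of_all _ hix, ?_⟩
  have hn : ∀ x, ∫ s, ‖f x * (-(p (k x) (g s) : ℂ))‖ ∂K = ‖f x‖ * ∫ s, p (k x) (g s) ∂K := by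
    intro x
    rw [← integral_const_mul]
    refine integral_congr_ae (ae_of_all _ fun s => ?_)
    simp only
    rw [norm_mul, norm_neg, Complex.norm_real, Real.norm_eq_abs,
      abs_of_nonneg (h.deriv_nonneg _ (hk0 x) _)]
  refine hfb.mono hmeas.norm.integral_prod_right' (ae_of_all _ fun x => ?_)
  have h0 : 0 ≤ ∫ s, p (k x) (g s) ∂K := integral_nonneg fun s => h.deriv_nonneg _ (hk0 x) _
  simp only [hn]
  rw [norm_smul, Real.norm_eq_abs, Real.norm_eq_abs, abs_of_nonneg (h0.trans (hb x)),
    abs_of_nonneg (by positivity), mul_comm]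
  exact mul_le_mul_of_nonneg_right (hb x) (norm_nonneg _)

/-- The two kernel integrals are nonnegative and, by the scalar equation, satisfy first + a · second
= κ m ≤ κ. Hence they are bounded by k and k/a, and integrability of k f suffices. -/
lemma integrable_caputoKernel_superposition [SFinite μ] (h : IsRelaxation α ν a m p) (hk : Measurable k)
    (hk0 : ∀ x, 0 ≤ k x) (hf : Integrable f μ) (hkf : Integrable (fun x => k x • f x) μ)
    (ha : 0 < a) {t : ℝ} (ht : 0 < t) :
    Integrable (fun q : X × ℝ => f q.1 * (-(p (k q.1) (t - q.2) : ℂ))) (μ.prod (caputoKernel α)) ∧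
    Integrable (fun q : X × ℝ => f q.1 * (-(p (k q.1) (t - q.2) : ℂ)))
      (μ.prod (caputoKernel ν)) := by
  have hnn : ∀ γ x, 0 ≤ ∫ s, p (k x) (t - s) ∂caputoKernel γ := fun γ x =>
    integral_nonneg fun s => h.deriv_nonneg _ (hk0 x) _
  have hle : ∀ x, ∫ s, p (k x) (t - s) ∂caputoKernel α
      + a * ∫ s, p (k x) (t - s) ∂caputoKernel ν ≤ k x := fun x => by
    rw [h.equation _ (hk0 x) t ht]
    exact mul_le_of_le_one_right (hk0 x) (h.le_one (hk0 x) t)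
  constructor
  · refine h.integrable_prod_superposition hk hk0 hf (by fun_prop)
      (fun x => h.integrable_left _ (hk0 x) t ht) (b := k) (fun x => ?_) hkf
    linarith [hle x, mul_nonneg ha.le (hnn ν x)]
  · refine h.integrable_prod_superposition hk hk0 hf (by fun_prop)
      (fun x => h.integrable_right _ (hk0 x) t ht) (b := fun x => a⁻¹ * k x) (fun x => ?_) ?_
    · rw [inv_mul_eq_div, le_div_iff₀ ha, mul_comm]
      linarith [hle x, hnn α x]
    · exact (hkf.smul a⁻¹).congr (ae_of_all _ fun x => by simp only [Pi.smul_apply, mul_smul])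

theorem hasCaputoDeriv_superposition [SFinite μ] (h : IsRelaxation α ν a m p) (hk : Measurable k)
    (hk0 : ∀ x, 0 ≤ k x) (hf : Integrable f μ) {γ : ℝ}
    (hint : ∀ t, 0 < t →
      Integrable (fun q : X × ℝ => f q.1 * (-(p (k q.1) (t - q.2) : ℂ))) (μ.prod (caputoKernel γ)))
    {u : ℝ → ℂ} (hu : ∀ t, 0 ≤ t → u t = ∫ x, f x * (m (k x) t : ℂ) ∂μ) :
    HasCaputoDeriv γ u := by
  have hw := h.indicator_deriv_superposition hk hk0 hf hu
  refine ⟨?_, fun t ht => ?_, fun t ht => ?_, fun hγ1 t ht => ?_⟩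
  · exact (h.continuous_superposition hk hk0 hf).continuousOn.congr hu
  · refine ((h.hasDerivAt_superposition hk hk0 hf ht).congr_of_eventuallyEq ?_).differentiableAt
    filter_upwards [Ioi_mem_nhds ht] with s hs
    exact hu s (le_of_lt hs)
  -- The integral of p over (0, t] is 1 - m ≤ 1, so the constant 1 dominates.
  · have h1 : Integrable (fun q : X × ℝ => f q.1 * (-(p (k q.1) q.2 : ℂ)))
        (μ.prod (volume.restrict (Ioc 0 t))) := by
      refine h.integrable_prod_superposition hk hk0 hf measurable_id
        (fun x => (h.intervalIntegrable (hk0 x) 0 t).1) (b := fun _ => 1) (fun x => ?_)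
        (by simpa using hf)
      have h2 := h.eq_one_sub (hk0 x) t
      rw [intervalIntegral.integral_of_le ht.le] at h2
      have h3 := h.nonneg _ (hk0 x) t
      simp only [id]
      linarith
    rw [intervalIntegrable_iff_integrableOn_Ioc_of_le ht.le]
    refine IntegrableOn.congr_fun (h1.integral_prod_right) (fun s hs => ?_) measurableSet_Ioc
    rw [← indicator_of_mem (show s ∈ Ioi (0 : ℝ) from hs.1) (deriv u), hw]
  · rw [← integrable_caputoKernel_iff hγ1 ht, hw]
    exact (hint t ht).integral_prod_right

/-- Fubini moves the time convolution inside the integral over x, where the scalar equation applies.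
-/
theorem equation_superposition [SFinite μ] (h : IsRelaxation α ν a m p) (hk : Measurable k)
    (hk0 : ∀ x, 0 ≤ k x) (hf : Integrable f μ) (hkf : Integrable (fun x => k x • f x) μ)
    (ha : 0 < a) (hα : α ≤ 1) (hν : ν ≤ 1)
    {u : ℝ → ℂ} (hu : ∀ t, 0 ≤ t → u t = ∫ x, f x * (m (k x) t : ℂ) ∂μ) {t : ℝ} (ht : 0 < t) :
    caputoDeriv α u t + (a : ℂ) * caputoDeriv ν u t
      = -∫ x, (k x • f x) * (m (k x) t : ℂ) ∂μ := by
  have hw := h.indicator_deriv_superposition hk hk0 hf hu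
  obtain ⟨hiα, hiν⟩ := h.integrable_caputoKernel_superposition hk hk0 hf hkf ha ht
  have hval : ∀ γ, Integrable (fun q : X × ℝ => f q.1 * (-(p (k q.1) (t - q.2) : ℂ)))
      (μ.prod (caputoKernel γ)) →
      Integrable (fun x => f x * (-((∫ s, p (k x) (t - s) ∂caputoKernel γ : ℝ) : ℂ))) μ ∧
      ∫ s, ∫ x, f x * (-(p (k x) (t - s) : ℂ)) ∂μ ∂caputoKernel γ
        = ∫ x, f x * (-((∫ s, p (k x) (t - s) ∂caputoKernel γ : ℝ) : ℂ)) ∂μ := by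
    intro γ hi
    have hin : ∀ x, ∫ s, f x * (-(p (k x) (t - s) : ℂ)) ∂caputoKernel γ
        = f x * (-((∫ s, p (k x) (t - s) ∂caputoKernel γ : ℝ) : ℂ)) := fun x => by
      rw [integral_const_mul, integral_neg, integral_complex_ofReal]
    constructor
    · simpa only [hin] using hi.integral_prod_left
    · rw [← integral_integral_swap (f := fun x s => f x * (-(p (k x) (t - s) : ℂ))) hi]
      simp_rw [hin]
  rw [caputoDeriv_eq_integral hα ht, caputoDeriv_eq_integral hν ht, hw]
  rw [(hval α hiα).2, (hval ν hiν).2, ← integral_const_mul,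
    ← integral_add (hval α hiα).1 ((hval ν hiν).1.const_mul _), ← integral_neg]
  refine integral_congr_ae (ae_of_all _ fun x => ?_)
  have he := congrArg (fun r : ℝ => (r : ℂ)) (h.equation _ (hk0 x) t ht)
  simp only [Complex.ofReal_add, Complex.ofReal_mul] at he
  simp only [Complex.real_smul]
  linear_combination (-f x) * he

end Superposition

end IsRelaxation

/-! ### Existence: the laws solve the Cauchy problem. -/

lemma pairing_toSignedMeasure {X : Type*} [MeasurableSpace X] (μ : Measure X) [IsFiniteMeasure μ]
    (φ : X → ℂ) : pairing μ.toSignedMeasure φ = ∫ x, φ x ∂μ :=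
  VectorMeasure.integral_toSignedMeasure

/-- A family of laws whose characteristic functions are relaxation functions solves the
fractional Cauchy problem. -/
theorem isSolution_of_charFun {n : ℕ} {α ν β c lam : ℝ} (hα : α ∈ Ioc (0 : ℝ) 1)
    (hν : ν ∈ Ioc (0 : ℝ) 1) (hβ : β ∈ Ioc (0 : ℝ) 1) (hlam : 0 < lam) {m p : ℝ → ℝ → ℝ}
    (h : IsRelaxation α ν (2 * lam) m p) (μ : ℝ → Measure (EuclideanSpace ℝ (Fin n)))
    [hfin : ∀ t, IsFiniteMeasure (μ t)] (hprob : ∀ t, 0 ≤ t → IsProbabilityMeasure (μ t))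
    (hμ : ∀ t, 0 ≤ t → ∀ ξ, charFun (μ t) ξ = (m (c ^ 2 * ‖ξ‖ ^ (2 * β)) t : ℂ)) :
    IsSolution α ν β c lam fun t => (μ t).toSignedMeasure := by
  have ha : 0 < 2 * lam := by positivity
  set k : EuclideanSpace ℝ (Fin n) → ℝ := fun ξ => c ^ 2 * fracSymbol β ξ with hk
  have hkm : Measurable k := (continuous_const.mul (continuous_fracSymbol hβ.1)).measurable
  have hk0 : ∀ ξ, 0 ≤ k ξ := fun ξ => mul_nonneg (sq_nonneg c) (fracSymbol_nonneg β ξ)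
  have hchar : ∀ t, 0 ≤ t → ∀ ξ, charFun (μ t) ((2 * Real.pi) • ξ) = (m (k ξ) t : ℂ) := by
    intro t ht ξ
    rw [hμ t ht, ← fracSymbol_eq_norm_smul]
  -- Writing φ = 𝓕⁻ 𝓕 φ and exchanging integrals exhibits the pairing as a superposition of
  -- relaxation functions with weight 𝓕 φ.
  have hu : ∀ φ : 𝓢(EuclideanSpace ℝ (Fin n), ℂ), ∀ t, 0 ≤ t →
      pairing (μ t).toSignedMeasure φ = ∫ ξ, 𝓕 φ ξ * (m (k ξ) t : ℂ) := by
    intro φ t ht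
    have hφ : Integrable (𝓕 (φ : EuclideanSpace ℝ (Fin n) → ℂ)) := (𝓕 φ).integrable
    have h1 : (φ : EuclideanSpace ℝ (Fin n) → ℂ) = 𝓕⁻ (𝓕 (φ : EuclideanSpace ℝ (Fin n) → ℂ)) :=
      (φ.continuous.fourierInv_fourier_eq φ.integrable hφ).symm
    rw [pairing_toSignedMeasure]
    conv_lhs => rw [h1]
    rw [integral_fourierInv_eq _ hφ]
    simp_rw [hchar t ht]
    rfl
  have hkf : ∀ φ : 𝓢(EuclideanSpace ℝ (Fin n), ℂ), Integrable fun ξ => k ξ • 𝓕 φ ξ := by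
    intro φ
    exact ((integrable_fracSymbol_mul hβ (𝓕 φ)).smul (c ^ 2)).congr
      (ae_of_all _ fun x => by simp only [Pi.smul_apply, hk, mul_smul])
  refine ⟨fun T => ⟨1, fun t ht _ => ?_⟩, ?_, fun φ => ?_, fun φ => ?_, fun φ t ht => ?_⟩
  · have := hprob t ht
    simp
  · have : μ 0 = Measure.dirac 0 := by
      refine Measure.ext_of_charFun (funext fun ξ => ?_)
      rw [hμ 0 le_rfl, h.apply_zero (by positivity), charFun_dirac]
      simp
    simp only [this]
  · exact h.hasCaputoDeriv_superposition hkm hk0 (𝓕 φ).integrable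
      (fun t ht => (h.integrable_caputoKernel_superposition hkm hk0 (𝓕 φ).integrable (hkf φ) ha ht).1)
      (hu φ)
  · exact h.hasCaputoDeriv_superposition hkm hk0 (𝓕 φ).integrable
      (fun t ht => (h.integrable_caputoKernel_superposition hkm hk0 (𝓕 φ).integrable (hkf φ) ha ht).2)
      (hu φ)
  · have h1 := h.equation_superposition hkm hk0 (𝓕 φ).integrable (hkf φ) ha hα.2 hν.2 (hu φ) ht
    have h2 : pairing (μ t).toSignedMeasure (fracLaplacian β φ)
        = ∫ ξ, (fracSymbol β ξ • 𝓕 φ ξ) * (m (k ξ) t : ℂ) := by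
      have hi : Integrable fun ξ => fracSymbol β ξ • 𝓕 (φ : EuclideanSpace ℝ (Fin n) → ℂ) ξ :=
        integrable_fracSymbol_mul hβ (𝓕 φ)
      rw [pairing_toSignedMeasure, fracLaplacian_eq, integral_fourierInv_eq _ hi]
      simp_rw [hchar t ht.le]
      rfl
    rw [h2]
    refine Eq.trans ?_ (h1.trans ?_)
    · push_cast
      rfl
    · rw [neg_mul, ← integral_const_mul]
      congr 1
      refine integral_congr_ae (ae_of_all _ fun ξ => ?_)
      simp only [hk, Complex.real_smul]
      push_cast
      ring

/-! ### Pairings with finite signed measures. -/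

section Pairing

variable {X : Type*} [MeasurableSpace X]

/-- The Jordan decomposition reduces pairings to integrals against finite positive measures, where
domination arguments are available. -/
lemma pairing_eq_sub (w : SignedMeasure X) {f : X → ℂ}
    (hp : Integrable f w.toJordanDecomposition.posPart)
    (hn : Integrable f w.toJordanDecomposition.negPart) :
    pairing w f = ∫ x, f x ∂w.toJordanDecomposition.posPart
      - ∫ x, f x ∂w.toJordanDecomposition.negPart := by
  conv_lhs => rw [← SignedMeasure.toSignedMeasure_toJordanDecomposition w]
  rw [JordanDecomposition.toSignedMeasure, pairing, VectorMeasure.integral_sub_vectorMeasure,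
    VectorMeasure.integral_toSignedMeasure, VectorMeasure.integral_toSignedMeasure]
  · rwa [VectorMeasure.Integrable, Measure.variation_toSignedMeasure]
  · rwa [VectorMeasure.Integrable, Measure.variation_toSignedMeasure]

lemma norm_pairing_le (w : SignedMeasure X) {f : X → ℂ} (hf : StronglyMeasurable f) {C : ℝ}
    (hC : ∀ x, ‖f x‖ ≤ C) : ‖pairing w f‖ ≤ C * (w.variation univ).toReal := by
  have hi : ∀ (ρ : Measure X) [IsFiniteMeasure ρ], Integrable f ρ := fun ρ _ =>
    Integrable.of_bound hf.aestronglyMeasurable C (ae_of_all _ hC)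
  have hb : ∀ (ρ : Measure X) [IsFiniteMeasure ρ], ‖∫ x, f x ∂ρ‖ ≤ C * ρ.real univ := fun ρ _ =>
    norm_integral_le_of_norm_le_const (ae_of_all _ hC)
  rw [pairing_eq_sub w (hi _) (hi _), ← SignedMeasure.totalVariation_eq_variation,
    SignedMeasure.totalVariation, Measure.add_apply,
    ENNReal.toReal_add (measure_ne_top _ _) (measure_ne_top _ _), mul_add]
  exact (norm_sub_le _ _).trans (add_le_add (hb _) (hb _))

lemma tendsto_pairing (w : SignedMeasure X) {f : ℕ → X → ℂ} {g : X → ℂ}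
    (hf : ∀ N, StronglyMeasurable (f N)) {C : ℝ} (hC : ∀ N x, ‖f N x‖ ≤ C)
    (hlim : ∀ x, Tendsto (fun N => f N x) atTop (𝓝 (g x))) :
    Tendsto (fun N => pairing w (f N)) atTop (𝓝 (pairing w g)) := by
  have hg : StronglyMeasurable g :=
    stronglyMeasurable_of_tendsto atTop hf (tendsto_pi_nhds.2 hlim)
  have hgC : ∀ x, ‖g x‖ ≤ C := fun x =>
    le_of_tendsto (hlim x).norm (Eventually.of_forall fun N => hC N x)
  have hi : ∀ (ρ : Measure X) [IsFiniteMeasure ρ] {f : X → ℂ}, StronglyMeasurable f →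
      (∀ x, ‖f x‖ ≤ C) → Integrable f ρ := fun ρ _ f hf hC =>
    Integrable.of_bound hf.aestronglyMeasurable C (ae_of_all _ hC)
  have ht : ∀ (ρ : Measure X) [IsFiniteMeasure ρ],
      Tendsto (fun N => ∫ x, f N x ∂ρ) atTop (𝓝 (∫ x, g x ∂ρ)) := fun ρ _ =>
    tendsto_integral_of_dominated_convergence (fun _ => C) (fun N => (hf N).aestronglyMeasurable)
      (integrable_const C) (fun N => ae_of_all _ (hC N)) (ae_of_all _ hlim)
  simp_rw [fun N => pairing_eq_sub w (hi _ (hf N) (hC N)) (hi _ (hf N) (hC N))]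
  rw [pairing_eq_sub w (hi _ hg hgC) (hi _ hg hgC)]
  exact (ht _).sub (ht _)

end Pairing

/-! ### Schwartz approximations of characters. -/

section TestFunctions

variable {n : ℕ}

local notation "E" => EuclideanSpace ℝ (Fin n)

/-- The character `x ↦ exp (i x · ξ)`. -/
noncomputable def character (ξ x : E) : ℂ := Complex.exp (inner ℝ x ξ * Complex.I)

lemma continuous_character (ξ : E) : Continuous (character ξ) := by
  unfold character; fun_prop

lemma norm_character (ξ x : E) : ‖character ξ x‖ = 1 := Complex.norm_exp_ofReal_mul_I _

/-- A finite signed measure on `ℝⁿ` is determined by its Fourier transform. -/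
lemma signedMeasure_ext_of_character {w w' : SignedMeasure E}
    (h : ∀ ξ, pairing w (character ξ) = pairing w' (character ξ)) : w = w' := by
  have hi : ∀ (ρ : Measure E) [IsFiniteMeasure ρ] (ξ : E), Integrable (character ξ) ρ :=
    fun ρ _ ξ => Integrable.of_bound (continuous_character ξ).aestronglyMeasurable 1
      (ae_of_all _ fun x => (norm_character ξ x).le)
  -- The negative parts are moved to the opposite sides so that uniqueness of characteristic
  -- functions for positive measures applies.
  have hm : w.toJordanDecomposition.posPart + w'.toJordanDecomposition.negPart
      = w'.toJordanDecomposition.posPart + w.toJordanDecomposition.negPart := by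
    refine Measure.ext_of_charFun (funext fun ξ => ?_)
    have h1 := h ξ
    rw [pairing_eq_sub w (hi _ ξ) (hi _ ξ), pairing_eq_sub w' (hi _ ξ) (hi _ ξ)] at h1
    change ∫ x, character ξ x ∂_ = ∫ x, character ξ x ∂_
    rw [integral_add_measure (hi _ ξ) (hi _ ξ), integral_add_measure (hi _ ξ) (hi _ ξ)]
    linear_combination h1
  refine VectorMeasure.ext fun s hs => ?_
  rw [w.apply_eq_posPart_real_sub_negPart_real hs, w'.apply_eq_posPart_real_sub_negPart_real hs]
  have h2 := congrArg (fun ρ : Measure E => ρ.real s) hm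
  rw [measureReal_add_apply, measureReal_add_apply] at h2
  linarith

lemma continuous_fourierInv {g : E → ℂ} (hg : Integrable g) : Continuous (𝓕⁻ g) := by
  simp_rw [funext (Real.fourierInv_eq' g)]
  refine continuous_of_dominated (bound := fun ξ => ‖g ξ‖) (fun x => ?_) (fun x => ?_) hg.norm ?_
  · have hc : Continuous fun ξ : E => Complex.exp ((2 * Real.pi * inner ℝ ξ x : ℝ) * Complex.I) := by
      fun_prop
    exact hc.aestronglyMeasurable.smul hg.aestronglyMeasurable
  · refine ae_of_all _ fun ξ => ?_
    rw [norm_smul, Complex.norm_exp_ofReal_mul_I, one_mul]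
  · exact ae_of_all _ fun ξ => by fun_prop

/-- A shrinking sequence of bump functions at the origin. -/
noncomputable def shrinkingBump (n N : ℕ) : ContDiffBump (0 : EuclideanSpace ℝ (Fin n)) where
  rIn := 1 / (N + 1) / 2
  rOut := 1 / (N + 1)
  rIn_pos := by positivity
  rIn_lt_rOut := half_lt_self (by positivity)

/-- The approximate identity at `ζ`. -/
noncomputable def approxDelta (ζ : E) (N : ℕ) (η : E) : ℝ :=
  (shrinkingBump n N).normed volume (ζ - η)

lemma approxDelta_nonneg (ζ : E) (N : ℕ) (η : E) : 0 ≤ approxDelta ζ N η :=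
  ContDiffBump.nonneg_normed _ _

lemma integral_approxDelta (ζ : E) (N : ℕ) : ∫ η, approxDelta ζ N η = 1 := by
  unfold approxDelta
  rw [integral_sub_left_eq_self (fun t => (shrinkingBump n N).normed volume t) volume ζ]
  exact ContDiffBump.integral_normed _

lemma integrable_approxDelta (ζ : E) (N : ℕ) : Integrable (approxDelta ζ N) :=
  (ContDiffBump.integrable_normed (shrinkingBump n N)).comp_sub_left ζ

/-- All the bumps live in one fixed ball, which gives bounds uniform in N. -/
lemma approxDelta_eq_zero {ζ : E} {N : ℕ} {η : E} (h : η ∉ Metric.closedBall ζ 1) :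
    approxDelta ζ N η = 0 := by
  have h1 : ζ - η ∉ Function.support ((shrinkingBump n N).normed volume) := by
    rw [ContDiffBump.support_normed_eq]
    intro h2
    refine h ?_
    have h3 : ‖ζ - η‖ < 1 / ((N : ℝ) + 1) := by simpa [shrinkingBump] using h2
    rw [Metric.mem_closedBall, dist_comm, dist_eq_norm]
    refine h3.le.trans ?_
    rw [div_le_one (by positivity)]
    linarith [(Nat.cast_nonneg N : (0 : ℝ) ≤ N)]
  simpa [approxDelta] using h1

lemma tendsto_integral_approxDelta (ζ : E) {G : E → ℂ} (hG : Continuous G) :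
    Tendsto (fun N => ∫ η, approxDelta ζ N η • G η) atTop (𝓝 (G ζ)) := by
  have h := ContDiffBump.convolution_tendsto_right_of_continuous (μ := volume)
    (φ := fun N => shrinkingBump n N) (l := atTop)
    (tendsto_one_div_add_atTop_nhds_zero_nat : Tendsto (fun N : ℕ => 1 / ((N : ℝ) + 1)) atTop (𝓝 0))
    hG ζ
  refine h.congr fun N => ?_
  rw [← integral_sub_left_eq_self (fun η => approxDelta ζ N η • G η) volume ζ]
  simp [convolution, approxDelta]

lemma norm_integral_approxDelta_le (ζ : E) (N : ℕ) {G : E → ℂ} {C : ℝ}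
    (hC : ∀ η ∈ Metric.closedBall ζ 1, ‖G η‖ ≤ C) : ‖∫ η, approxDelta ζ N η • G η‖ ≤ C := by
  calc ‖∫ η, approxDelta ζ N η • G η‖ ≤ ∫ η, approxDelta ζ N η * C := by
        refine norm_integral_le_of_norm_le ((integrable_approxDelta ζ N).mul_const C)
          (ae_of_all _ fun η => ?_)
        rw [norm_smul, Real.norm_eq_abs, abs_of_nonneg (approxDelta_nonneg ζ N η)]
        by_cases h : η ∈ Metric.closedBall ζ 1
        · exact mul_le_mul_of_nonneg_left (hC η h) (approxDelta_nonneg ζ N η)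
        · simp [approxDelta_eq_zero h]
    _ = C := by rw [integral_mul_const, integral_approxDelta, one_mul]

lemma exists_schwartz_approxDelta (ζ : E) (N : ℕ) :
    ∃ ψ : 𝓢(E, ℂ), ∀ η, ψ η = (approxDelta ζ N η : ℂ) := by
  have hs : HasCompactSupport (approxDelta ζ N) :=
    (ContDiffBump.hasCompactSupport_normed (shrinkingBump n N)).comp_homeomorph
      (Homeomorph.subLeft ζ)
  have hc : ContDiff ℝ ((⊤ : ℕ∞) : WithTop ℕ∞) (approxDelta ζ N) :=
    (ContDiffBump.contDiff_normed (n := ⊤) (shrinkingBump n N)).comp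
      (contDiff_const.sub contDiff_id)
  have hs' : HasCompactSupport fun η => (approxDelta ζ N η : ℂ) :=
    hs.comp_left (g := fun r : ℝ => (r : ℂ)) Complex.ofReal_zero
  exact ⟨hs'.toSchwartzMap (Complex.ofRealCLM.contDiff.comp hc), fun η => rfl⟩

/-- Schwartz functions approximating a character, boundedly together with their fractional
Laplacians. -/
lemma exists_schwartz_tendsto_character {β : ℝ} (hβ : β ∈ Ioc (0 : ℝ) 1) (ξ : E) :
    ∃ (φ : ℕ → 𝓢(E, ℂ)) (C : ℝ), (∀ N x, ‖φ N x‖ ≤ C) ∧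
      (∀ N x, ‖fracLaplacian β (φ N) x‖ ≤ C) ∧ (∀ N, Continuous (fracLaplacian β (φ N))) ∧
      (∀ x, Tendsto (fun N => φ N x) atTop (𝓝 (character ξ x))) ∧
      ∀ x, Tendsto (fun N => fracLaplacian β (φ N) x) atTop
        (𝓝 (((‖ξ‖ ^ (2 * β) : ℝ) : ℂ) * character ξ x)) := by
  -- The test functions are inverse Fourier transforms of bumps concentrating at ζ = ξ/(2π). The
  -- fractional Laplacian multiplies each bump by the symbol, which is continuous and hence bounded
  -- on the common ball.
  set ζ : E := (2 * Real.pi)⁻¹ • ξ with hζ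
  have hζξ : (2 * Real.pi) • ζ = ξ := by
    rw [hζ, smul_smul, mul_inv_cancel₀ Real.two_pi_pos.ne', one_smul]
  choose ψ hψ using exists_schwartz_approxDelta (n := n) ζ
  set e : E → E → ℂ := fun x η => Complex.exp ((2 * Real.pi * inner ℝ η x : ℝ) * Complex.I) with he
  have hec : ∀ x, Continuous (e x) := fun x => by fun_prop
  have hen : ∀ x η, ‖e x η‖ = 1 := fun x η => Complex.norm_exp_ofReal_mul_I _
  have heζ : ∀ x, e x ζ = character ξ x := by
    intro x
    simp only [he, character]
    rw [← hζξ, inner_smul_right, real_inner_comm]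
  have hφ : ∀ N x, 𝓕⁻ (ψ N) x = ∫ η, approxDelta ζ N η • e x η := by
    intro N x
    rw [SchwartzMap.fourierInv_coe, Real.fourierInv_eq']
    refine integral_congr_ae (ae_of_all _ fun η => ?_)
    simp only [hψ, he, smul_eq_mul, Complex.real_smul, mul_comm]
  have hL' : ∀ N, fracLaplacian β (𝓕⁻ (ψ N) : 𝓢(E, ℂ)) = 𝓕⁻ fun η => fracSymbol β η • ψ N η := by
    intro N
    rw [fracLaplacian_eq, ← SchwartzMap.fourier_coe, FourierTransform.fourier_fourierInv_eq]
  have hL : ∀ N x, fracLaplacian β (𝓕⁻ (ψ N) : 𝓢(E, ℂ)) x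
      = ∫ η, approxDelta ζ N η • (fracSymbol β η • e x η) := by
    intro N x
    rw [hL', Real.fourierInv_eq']
    refine integral_congr_ae (ae_of_all _ fun η => ?_)
    simp only [hψ, he, smul_eq_mul, Complex.real_smul]
    ring
  have hsc : Continuous (fracSymbol (n := n) β) := continuous_fracSymbol hβ.1
  obtain ⟨M, hM⟩ := (isCompact_closedBall ζ 1).exists_bound_of_continuousOn hsc.continuousOn
  refine ⟨fun N => 𝓕⁻ (ψ N), max 1 M, fun N x => ?_, fun N x => ?_, fun N => ?_, fun x => ?_,
    fun x => ?_⟩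
  · rw [hφ]
    exact norm_integral_approxDelta_le ζ N fun η _ => (hen x η).le.trans (le_max_left _ _)
  · rw [hL]
    refine norm_integral_approxDelta_le ζ N fun η hη => ?_
    rw [norm_smul, hen, mul_one]
    exact (hM η hη).trans (le_max_right _ _)
  · rw [hL']
    exact continuous_fourierInv (integrable_fracSymbol_mul hβ (ψ N))
  · simp_rw [hφ, ← heζ]
    exact tendsto_integral_approxDelta ζ (hec x)
  · simp_rw [hL]
    have := tendsto_integral_approxDelta ζ (hsc.smul (hec x))
    rw [Pi.smul_apply', heζ, fracSymbol_eq_norm_smul, hζξ, Complex.real_smul] at this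
    exact this

end TestFunctions

/-! ### Convolution of the equation with the potential. -/

section Resolvent

variable {α ν a κ γ : ℝ} {u : ℝ → ℂ}

lemma HasCaputoDeriv.integral_deriv (hu : HasCaputoDeriv γ u) {t : ℝ} (ht : 0 < t) :
    IntegrableOn (fun x => (Ioi 0).indicator (deriv u) (t - x)) (Ioi 0) ∧
      ∫ x in Ioi 0, (Ioi 0).indicator (deriv u) (t - x) = u t - u 0 := by
  have hind : ((Ioi (0 : ℝ)).indicator fun x => (Ioi 0).indicator (deriv u) (t - x))
      = (Ioo 0 t).indicator fun x => deriv u (t - x) := by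
    ext s
    by_cases h0 : 0 < s <;> by_cases h1 : s < t <;> simp [indicator, h0, h1]
  have hi := hu.integrable t ht
  have hi' : IntervalIntegrable (fun x => deriv u (t - x)) volume 0 t := by
    simpa using (hi.comp_sub_left t enorm_ne_top).symm
  constructor
  · rw [← integrable_indicator_iff measurableSet_Ioi, hind,
      integrable_indicator_iff measurableSet_Ioo]
    exact (intervalIntegrable_iff_integrableOn_Ioo_of_le ht.le).1 hi'
  · rw [← integral_indicator measurableSet_Ioi, hind, integral_indicator measurableSet_Ioo,
      ← integral_Ioc_eq_integral_Ioo, ← intervalIntegral.integral_of_le ht.le,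
      intervalIntegral.integral_comp_sub_left (fun x => deriv u x) t]
    simp only [sub_self, sub_zero]
    exact intervalIntegral.integral_eq_sub_of_hasDerivAt_of_le ht.le
      (hu.continuousOn.mono Icc_subset_Ici_self)
      (fun x hx => (hu.differentiableAt x hx.1).hasDerivAt) hi

lemma setIntegral_indicator_sub_of_nonpos {K : Measure ℝ} (hK : K (Iio 0) = 0) (v : ℝ → ℂ) {t : ℝ}
    (ht : t ≤ 0) : ∫ x, (Ioi 0).indicator v (t - x) ∂K = 0 := by
  refine integral_eq_zero_of_ae ?_
  filter_upwards [ae_nonneg_of_Iio hK] with x hx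
  exact indicator_of_notMem (by simp only [mem_Ioi, not_lt]; linarith) _

lemma integrable_integral_conv {A B : Measure ℝ} [SFinite A] [SFinite B] {g : ℝ → ℂ}
    (hg : Integrable g (A ∗ B)) : Integrable (fun y => ∫ x, g (y + x) ∂B) A := by
  have : Integrable (g ∘ fun q : ℝ × ℝ => q.1 + q.2) (A.prod B) :=
    (integrable_map_measure hg.1 (by fun_prop)).1 hg
  exact this.integral_prod_left

/-- Convolving the equation with the potential. -/
theorem IsPotential.integral_caputoDeriv {U : Measure ℝ} (hU : IsPotential α ν a κ U)
    (hα : α ≤ 1) (hν : ν ≤ 1) (ha : 0 < a) (hκ : 0 ≤ κ) (huα : HasCaputoDeriv α u)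
    (huν : HasCaputoDeriv ν u) {T : ℝ} (hT : 0 < T) :
    IntegrableOn (fun y => caputoDeriv α u (T - y) + (a : ℂ) * caputoDeriv ν u (T - y))
      (Iio T) U ∧
    ∫ y in Iio T, (caputoDeriv α u (T - y) + (a : ℂ) * caputoDeriv ν u (T - y)) ∂U
      = (u T - u 0) - κ * ∫ y in Iio T, (u (T - y) - u 0) ∂U := by
  have := hU.sFinite
  set V : Measure ℝ := volume.restrict (Ioi 0)
  set g : ℝ → ℂ := fun z => (Ioi 0).indicator (deriv u) (T - z) with hg
  have hres := hU.memoryKernel_conv hα hν ha hκ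
  obtain ⟨hgV, hgI⟩ := huα.integral_deriv hT
  -- By the resolvent identity this sum is Lebesgue measure on (0, ∞), so integrability of u' is all
  -- that is needed. Positivity of the summands then yields integrability against each.
  have hsum : Integrable g (memoryKernel α ν a ∗ U + ENNReal.ofReal κ • (V ∗ U)) := by
    rw [hres]; exact hgV
  have h1 : Integrable g (U ∗ memoryKernel α ν a) := by
    rw [Measure.conv_comm]; exact hsum.left_of_add_measure
  have h2 : Integrable g (ENNReal.ofReal κ • (U ∗ V)) := by
    rw [Measure.conv_comm]; exact hsum.right_of_add_measure
  have hval : u T - u 0 = ∫ z, g z ∂(U ∗ memoryKernel α ν a)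
      + ∫ z, g z ∂(ENNReal.ofReal κ • (U ∗ V)) := by
    rw [← hgI, Measure.conv_comm U, Measure.conv_comm U,
      ← integral_add_measure hsum.left_of_add_measure hsum.right_of_add_measure, hres]
  have hgadd : ∀ y x, g (y + x) = (Ioi 0).indicator (deriv u) (T - y - x) := fun y x => by
    rw [hg]; simp only [sub_sub]
  have hmem : memoryKernel α ν a (Iio 0) = 0 := by simp [memoryKernel, caputoKernel_Iio]
  have hinner1 : (fun y => ∫ x, g (y + x) ∂memoryKernel α ν a) = (Iio T).indicator fun y =>
      caputoDeriv α u (T - y) + (a : ℂ) * caputoDeriv ν u (T - y) := by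
    ext y
    simp_rw [hgadd]
    by_cases hy : y < T
    · have hy' : 0 < T - y := sub_pos.2 hy
      rw [indicator_of_mem (show y ∈ Iio T from hy), memoryKernel,
        integral_add_measure (huα.integrable_caputoKernel hα hy')
        ((huν.integrable_caputoKernel hν hy').smul_measure ENNReal.ofReal_ne_top),
        integral_smul_measure, ← caputoDeriv_eq_integral hα hy', ← caputoDeriv_eq_integral hν hy',
        ENNReal.toReal_ofReal ha.le, Complex.real_smul]
    · rw [indicator_of_notMem (by simpa using hy)]
      exact setIntegral_indicator_sub_of_nonpos hmem _ (by linarith)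
  have hinner2 : (fun y => ∫ x, g (y + x) ∂V) = (Iio T).indicator fun y => u (T - y) - u 0 := by
    ext y
    simp_rw [hgadd]
    by_cases hy : y < T
    · rw [indicator_of_mem (show y ∈ Iio T from hy)]
      exact (huα.integral_deriv (sub_pos.2 hy)).2
    · rw [indicator_of_notMem (by simpa using hy)]
      exact setIntegral_indicator_sub_of_nonpos volume_Ioi_Iio _ (by linarith)
  have hI2 : ∫ z, g z ∂(ENNReal.ofReal κ • (U ∗ V))
      = κ * ∫ y in Iio T, (u (T - y) - u 0) ∂U := by
    -- For κ = 0 the scaled measure is zero and says nothing about integrability against U ∗ V, so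
    -- this case is separate.
    rcases hκ.eq_or_lt with h0 | h0
    · simp [← h0]
    · have h2' : Integrable g (U ∗ V) :=
        (integrable_smul_measure (by simpa using h0) ENNReal.ofReal_ne_top).1 h2
      rw [integral_smul_measure, integral_conv h2', hinner2, integral_indicator measurableSet_Iio,
        ENNReal.toReal_ofReal hκ, Complex.real_smul]
  have hI1 : Integrable ((Iio T).indicator fun y =>
      caputoDeriv α u (T - y) + (a : ℂ) * caputoDeriv ν u (T - y)) U := by
    rw [← hinner1]
    exact integrable_integral_conv h1
  refine ⟨(integrable_indicator_iff measurableSet_Iio).1 hI1, ?_⟩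
  rw [hval, hI2, integral_conv h1, hinner1, integral_indicator measurableSet_Iio]
  ring

end Resolvent

/-! ### Uniqueness through the Fourier transform. -/

section Uniqueness

variable {n : ℕ} {α ν β c lam : ℝ} {w : ℝ → SignedMeasure (EuclideanSpace ℝ (Fin n))}

lemma pairing_const_mul_character (w : SignedMeasure (EuclideanSpace ℝ (Fin n))) (z : ℂ)
    (ξ : EuclideanSpace ℝ (Fin n)) :
    pairing w (fun x => z * character ξ x) = z * pairing w (character ξ) := by
  have hi : ∀ (ρ : Measure (EuclideanSpace ℝ (Fin n))) [IsFiniteMeasure ρ],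
      Integrable (character ξ) ρ :=
    fun ρ _ => Integrable.of_bound (continuous_character ξ).aestronglyMeasurable 1
      (ae_of_all _ fun x => (norm_character ξ x).le)
  rw [pairing_eq_sub w ((hi _).const_mul z) ((hi _).const_mul z), pairing_eq_sub w (hi _) (hi _),
    integral_const_mul, integral_const_mul, mul_sub]

/-- The Fourier transform of a solution. -/
theorem IsSolution.pairing_character (hw : IsSolution α ν β c lam w) (hα : α ≤ 1) (hν : ν ≤ 1)
    (hβ : β ∈ Ioc (0 : ℝ) 1) (hlam : 0 < lam) (ξ : EuclideanSpace ℝ (Fin n)) {U : Measure ℝ}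
    (hU : IsPotential α ν (2 * lam) (c ^ 2 * ‖ξ‖ ^ (2 * β)) U) {T : ℝ} (hT : 0 < T) :
    pairing (w T) (character ξ) = ((1 - c ^ 2 * ‖ξ‖ ^ (2 * β) * U.real (Iio T) : ℝ) : ℂ) := by
  set κ : ℝ := c ^ 2 * ‖ξ‖ ^ (2 * β) with hκdef
  have hκ : 0 ≤ κ := by positivity
  have hUfin : U (Iio T) < ∞ :=
    (measure_mono Iio_subset_Iic_self).trans_lt (hU.measure_Iic_lt_top T)
  set ρ : Measure ℝ := U.restrict (Iio T) with hρ
  have : IsFiniteMeasure ρ := ⟨by rw [hρ, Measure.restrict_apply_univ]; exact hUfin⟩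
  have hρae : ∀ᵐ y ∂ρ, 0 ≤ T - y ∧ T - y ≤ T ∧ y < T := by
    filter_upwards [ae_restrict_of_ae (ae_nonneg_of_Iio hU.measure_Iio),
      ae_restrict_mem measurableSet_Iio] with y h0 hy
    have hy' : y < T := hy
    exact ⟨by linarith, by linarith, hy'⟩
  obtain ⟨φ, C, hφC, hLC, hLc, hφlim, hLlim⟩ := exists_schwartz_tendsto_character hβ ξ
  obtain ⟨M, hM⟩ := hw.bounded T
  have hC0 : 0 ≤ C := (norm_nonneg _).trans (hφC 0 0)
  have hbound : ∀ t, 0 ≤ t → t ≤ T → ∀ {f : EuclideanSpace ℝ (Fin n) → ℂ}, StronglyMeasurable f →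
      (∀ x, ‖f x‖ ≤ C) → ‖pairing (w t) f‖ ≤ C * M := by
    intro t h0 h1 f hf hfC
    refine (norm_pairing_le (w t) hf hfC).trans (mul_le_mul_of_nonneg_left ?_ hC0)
    exact ENNReal.toReal_le_coe_of_le_coe (hM t h0 h1)
  have hφm : ∀ N, StronglyMeasurable (φ N) := fun N => (φ N).continuous.stronglyMeasurable
  have hLm : ∀ N, StronglyMeasurable (fracLaplacian β (φ N)) := fun N => (hLc N).stronglyMeasurable
  have hulim : ∀ t, Tendsto (fun N => pairing (w t) (φ N)) atTop
      (𝓝 (pairing (w t) (character ξ))) := fun t => tendsto_pairing (w t) hφm hφC hφlim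
  have hLlim' : ∀ t, Tendsto (fun N => -((c : ℂ) ^ 2) * pairing (w t) (fracLaplacian β (φ N))) atTop
      (𝓝 (-(κ : ℂ) * pairing (w t) (character ξ))) := by
    intro t
    have := (tendsto_pairing (w t) hLm hLC hLlim).const_mul (-((c : ℂ) ^ 2))
    rw [pairing_const_mul_character] at this
    convert this using 2
    rw [hκdef]
    push_cast
    ring
  have hres := fun N => hU.integral_caputoDeriv hα hν (by positivity) hκ (hw.regular_left (φ N))
    (hw.regular_right (φ N)) hT
  have heq : ∀ N, EqOn (fun y => caputoDeriv α (fun t => pairing (w t) (φ N)) (T - y)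
      + ((2 * lam : ℝ) : ℂ) * caputoDeriv ν (fun t => pairing (w t) (φ N)) (T - y))
      (fun y => -((c : ℂ) ^ 2) * pairing (w (T - y)) (fracLaplacian β (φ N))) (Iio T) := by
    intro N y hy
    refine Eq.trans ?_ (hw.equation (φ N) (T - y) (sub_pos.2 hy))
    push_cast
    rfl
  have hmeasL : ∀ N, AEStronglyMeasurable
      (fun y => -((c : ℂ) ^ 2) * pairing (w (T - y)) (fracLaplacian β (φ N))) ρ := fun N =>
    (((hres N).1.congr_fun (heq N) measurableSet_Iio)).aestronglyMeasurable
  have hmeasU : ∀ N, AEStronglyMeasurable (fun y => pairing (w (T - y)) (φ N)) ρ := by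
    intro N
    refine ContinuousOn.aestronglyMeasurable ?_ measurableSet_Iio
    exact (hw.regular_left (φ N)).continuousOn.comp (by fun_prop)
      fun y (hy : y < T) => mem_Ici.2 (sub_nonneg.2 hy.le)
  set Y : ℝ → ℂ := fun y => pairing (w (T - y)) (character ξ) with hY
  -- Time regularity is assumed only for Schwartz test functions; for the character, measurability
  -- comes from the limit.
  have hYm : AEStronglyMeasurable Y ρ :=
    aestronglyMeasurable_of_tendsto_ae atTop hmeasU (ae_of_all _ fun y => hulim (T - y))
  have hYi : Integrable Y ρ := by
    refine Integrable.of_bound hYm (C * M) ?_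
    filter_upwards [hρae] with y hy
    exact le_of_tendsto (hulim (T - y)).norm
      (Eventually.of_forall fun N => hbound _ hy.1 hy.2.1 (hφm N) (hφC N))
  have hlim1 : Tendsto (fun N => ∫ y, -((c : ℂ) ^ 2)
      * pairing (w (T - y)) (fracLaplacian β (φ N)) ∂ρ) atTop (𝓝 (∫ y, -(κ : ℂ) * Y y ∂ρ)) := by
    refine tendsto_integral_of_dominated_convergence (fun _ => ‖(c : ℂ) ^ 2‖ * (C * M)) hmeasL
      (integrable_const _) (fun N => ?_) (ae_of_all _ fun y => hLlim' (T - y))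
    filter_upwards [hρae] with y hy
    rw [norm_mul, norm_neg]
    exact mul_le_mul_of_nonneg_left (hbound _ hy.1 hy.2.1 (hLm N) (hLC N)) (norm_nonneg _)
  have hlim2 : Tendsto (fun N => ∫ y, (pairing (w (T - y)) (φ N) - pairing (w 0) (φ N)) ∂ρ) atTop
      (𝓝 (∫ y, (Y y - pairing (w 0) (character ξ)) ∂ρ)) := by
    refine tendsto_integral_of_dominated_convergence (fun _ => C * M + C * M)
      (fun N => (hmeasU N).sub aestronglyMeasurable_const)
      (integrable_const _) (fun N => ?_) (ae_of_all _ fun y => (hulim (T - y)).sub (hulim 0))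
    filter_upwards [hρae] with y hy
    exact (norm_sub_le _ _).trans (add_le_add (hbound _ hy.1 hy.2.1 (hφm N) (hφC N))
      (hbound 0 le_rfl hT.le (hφm N) (hφC N)))
  have hid : ∀ N, ∫ y, -((c : ℂ) ^ 2) * pairing (w (T - y)) (fracLaplacian β (φ N)) ∂ρ
      = (pairing (w T) (φ N) - pairing (w 0) (φ N))
        - κ * ∫ y, (pairing (w (T - y)) (φ N) - pairing (w 0) (φ N)) ∂ρ := by
    intro N
    rw [hρ, ← setIntegral_congr_fun measurableSet_Iio (heq N)]
    exact (hres N).2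
  -- Since κ is the symbol at ξ, the term -κ ∫ Y appears on both sides and cancels. What remains is
  -- an explicit formula, so no Gronwall or Volterra argument is needed.
  have hfinal := tendsto_nhds_unique (hlim1.congr hid)
    (((hulim T).sub (hulim 0)).sub (hlim2.const_mul (κ : ℂ)))
  have hone : pairing (w 0) (character ξ) = 1 := by
    rw [hw.initial, pairing_toSignedMeasure, integral_dirac]
    simp [character]
  rw [hone, integral_sub hYi (integrable_const _), integral_const_mul, integral_const] at hfinal
  have hreal : ρ.real univ = U.real (Iio T) := by
    rw [Measure.real, hρ, Measure.restrict_apply_univ, Measure.real]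
  rw [hreal, Complex.real_smul] at hfinal
  push_cast
  linear_combination -hfinal

end Uniqueness

end FracCauchy

theorem corollary2p1 {n : ℕ} {α ν β c lam : ℝ}
    (hα : α ∈ Set.Ioc (0 : ℝ) 1) (hν : ν ∈ Set.Ioc (0 : ℝ) 1) (hβ : β ∈ Set.Ioc (0 : ℝ) 1)
    (hc : 0 < c) (hlam : 0 < lam)
    {Ω : Type*} [MeasurableSpace Ω] (P : Measure Ω) [IsProbabilityMeasure P]
    (S : ℝ≥0 → Ω → EuclideanSpace ℝ (Fin n)) (H₁ H₂ : ℝ≥0 → Ω → ℝ)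
    (hS : FracCauchy.IsIsotropicStable β S P)
    (hH₁ : FracCauchy.IsStableSubordinator α H₁ P)
    (hH₂ : FracCauchy.IsStableSubordinator ν H₂ P)
    (hindH : IndepFun (fun ω t => H₁ t ω) (fun ω t => H₂ t ω) P)
    (hindS : IndepFun (fun ω t => S t ω) (fun ω => (fun t => H₁ t ω, fun t => H₂ t ω)) P) :
    (∀ t : ℝ, 0 ≤ t → AEMeasurable (FracCauchy.composedProcess c lam ν S H₁ H₂ t) P) ∧
    FracCauchy.IsSolution α ν β c lam
      (fun t => (P.map (FracCauchy.composedProcess c lam ν S H₁ H₂ t)).toSignedMeasure) ∧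
    ∀ w : ℝ → SignedMeasure (EuclideanSpace ℝ (Fin n)),
      FracCauchy.IsSolution α ν β c lam w →
      ∀ t : ℝ, 0 ≤ t →
        w t = (P.map (FracCauchy.composedProcess c lam ν S H₁ H₂ t)).toSignedMeasure := by
  have hH := FracCauchy.hasLaplaceExponent_combinedSubordinator hν.1 hlam hH₁ hH₂ hindH
  have ha : 0 < 2 * lam := by positivity
  have hmeas : ∀ t, AEMeasurable (FracCauchy.composedProcess c lam ν S H₁ H₂ t) P := fun t =>
    FracCauchy.aemeasurable_composedProcess hν.1 hlam hS hH₁ hH₂ hindH hindS t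
  obtain ⟨p, hp⟩ := hH.exists_isRelaxation hα hν ha
  have hsol : FracCauchy.IsSolution α ν β c lam
      (fun t => (P.map (FracCauchy.composedProcess c lam ν S H₁ H₂ t)).toSignedMeasure) :=
    FracCauchy.isSolution_of_charFun hα hν hβ hlam hp _
      (fun t _ => Measure.isProbabilityMeasure_map (hmeas t))
      fun t _ ξ => FracCauchy.charFun_composedProcess hν.1 hlam hS hH₁ hH₂ hindH hindS t ξ
  refine ⟨fun t _ => hmeas t, hsol, fun w hw t ht => ?_⟩
  rcases ht.eq_or_lt with rfl | ht
  · rw [hw.initial]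
    exact hsol.initial.symm
  · refine FracCauchy.signedMeasure_ext_of_character fun ξ => ?_
    have hU := hH.isPotential ha (by positivity : 0 ≤ c ^ 2 * ‖ξ‖ ^ (2 * β))
    -- The same explicit Fourier transform is obtained for w and for the constructed solution. The
    -- time 0 is treated separately because that formula concerns T > 0.
    rw [hw.pairing_character hα.2 hν.2 hβ hlam ξ hU ht,
      ← hsol.pairing_character hα.2 hν.2 hβ hlam ξ hU ht]
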